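/- Let $q$ be a prime power and let $d$ be an integer with $2\le d\le q+1$. Let $S\subset\mathbb P^3$ be a surface of degree $d$ defined over $\mathbb F_q$, i.e. the zero locus (over $\overline{\mathbb F}_q$) of a nonzero homogeneous polynomial $F\in\mathbb F_q[X_0,X_1,X_2,X_3]$ of degree $d$, and suppose that $S$ has no $\mathbb F_q$-plane components, i.e. that no nonzero linear form over $\mathbb F_q$ divides $F$. Suppose that the number of $\mathbb F_q$-points of $S$ is $$N_q(S)=(d-1)q^2+dq+1 .$$ A *planar $\mathbb F_q$-pencil of degree $d$* is a union $Z=l_1\cup\dots\cup l_d$ of $d$ distinct lines of $\mathbb P^3$ defined over $\mathbb F_q$ that all lie in one plane defined over $\mathbb F_q$ and satisfy $l_1\cap\dots\cap l_d\neq\emptyset$; the unique point $v_Z$ of $l_1\cap\dots\cap l_d$ is called the vertex of $Z$. Let $l$ be a line of $\mathbb P^3$ defined over $\mathbb F_q$ and contained in $S$. Denote by $\check l(\mathbb F_q)$ the set of planes of $\mathbb P^3$ defined over $\mathbb F_q$ that contain $l$, and by $l(\mathbb F_q)$ the set of $\mathbb F_q$-points of $l$. Then: 1. for every $H\in\check l(\mathbb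 F_q)$, the intersection $S\cap H$ is a planar $\mathbb F_q$-pencil of degree $d$; 2. the map $\check l(\mathbb F_q)\to l(\mathbb F_q)$, $H\mapsto v_{S\cap H}$, is well defined and bijective. -/

import Mathlib

/-- Projective 3-space: the points over the algebraic closure of the base field `K`. -/
abbrev PThree (K : Type*) [Field K] : Type _ :=
  Projectivization (AlgebraicClosure K) (Fin 4 → AlgebraicClosure K)

/-- The inclusion of `K⁴` into `K̄⁴`, semilinear over `K → K̄`. -/
noncomputable def ratVec (K : Type*) [Field K] :
    (Fin 4 → K) →ₛₗ[algebraMap K (AlgebraicClosure K)] (Fin 4 → AlgebraicClosure K) where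
  toFun v := fun i => algebraMap K (AlgebraicClosure K) (v i)
  map_add' v w := by
    funext i
    simp
  map_smul' c v := by
    funext i
    simp

theorem ratVec_injective (K : Type*) [Field K] : Function.Injective (ratVec K) := by
  intro v w h
  funext i
  exact (algebraMap K (AlgebraicClosure K)).injective (congrFun h i)

/-- The inclusion `ℙ³(K) → ℙ³(K̄)`. -/
noncomputable def ratPoint (K : Type*) [Field K] : Projectivization K (Fin 4 → K) → PThree K :=
  Projectivization.map (ratVec K) (ratVec_injective K)

/-- The set `X(K)` of the `K`-points of a subset `X` of `ℙ³`. -/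
def ratPoints {K : Type*} [Field K] (X : Set (PThree K)) : Set (PThree K) :=
  X ∩ Set.range (ratPoint K)

/-- The number of `K`-points of `X`. -/
noncomputable def numRatPoints {K : Type*} [Field K] (X : Set (PThree K)) : ℕ :=
  (ratPoints X).ncard

/-- The surface `{F = 0}` in `ℙ³`, for a homogeneous polynomial `F` over `K` (for such an `F` the
condition does not depend on the representative of `P`). -/
def surfaceOf {K : Type*} [Field K] (F : MvPolynomial (Fin 4) K) : Set (PThree K) :=
  {P | MvPolynomial.aeval P.rep F = 0}

/-- The surface `{F = 0}` has no component that is a plane over `K`: no nonzero linear form over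
`K` divides `F`. -/
def HasNoPlaneComponent {K : Type*} [Field K] (F : MvPolynomial (Fin 4) K) : Prop :=
  ∀ L : MvPolynomial (Fin 4) K, L ≠ 0 → L.IsHomogeneous 1 → ¬ L ∣ F

/-- The linear subvariety of `ℙ³` defined by a `K`-subspace `W` of `K⁴`: the points over `K̄` that
lie in the `K̄`-subspace of `K̄⁴` spanned by `W`. -/
def linearLocus {K : Type*} [Field K] (W : Submodule K (Fin 4 → K)) : Set (PThree K) :=
  {P | P.submodule ≤ Submodule.span (AlgebraicClosure K) (ratVec K '' (W : Set (Fin 4 → K)))}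

/-- `l` is a line of `ℙ³` defined over `K`. -/
def IsRatLine {K : Type*} [Field K] (l : Set (PThree K)) : Prop :=
  ∃ W : Submodule K (Fin 4 → K), Module.finrank K W = 2 ∧ l = linearLocus W

/-- `H` is a plane of `ℙ³` defined over `K`. -/
def IsRatPlane {K : Type*} [Field K] (H : Set (PThree K)) : Prop :=
  ∃ W : Submodule K (Fin 4 → K), Module.finrank K W = 3 ∧ H = linearLocus W

/-- `Z` is the union of the `d ≥ 2` distinct lines `l i` over `K`, which lie on a common plane over
`K` and have a common point. -/
def IsPencilOfLines {K : Type*} [Field K] (d : ℕ) (Z : Set (PThree K))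
    (l : Fin d → Set (PThree K)) : Prop :=
  2 ≤ d ∧ Function.Injective l ∧ (∀ i, IsRatLine (l i)) ∧
    (∃ H : Set (PThree K), IsRatPlane H ∧ ∀ i, l i ⊆ H) ∧
    (⋂ i, l i).Nonempty ∧ Z = ⋃ i, l i

/-- `Z` is a planar pencil of degree `d` over `K`. -/
def IsPlanarPencil {K : Type*} [Field K] (d : ℕ) (Z : Set (PThree K)) : Prop :=
  ∃ l : Fin d → Set (PThree K), IsPencilOfLines d Z l

/-- `Z` is a planar pencil of degree `d` over `K` with vertex `v`: the lines of the pencil meet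
exactly in `v`. -/
def IsPencilVertex {K : Type*} [Field K] (d : ℕ) (Z : Set (PThree K)) (v : PThree K) : Prop :=
  ∃ l : Fin d → Set (PThree K), IsPencilOfLines d Z l ∧ (⋂ i, l i) = {v}

/-- The planes over `K` that contain `l`. -/
def ratPlanesThrough {K : Type*} [Field K] (l : Set (PThree K)) : Set (Set (PThree K)) :=
  {H | IsRatPlane H ∧ l ⊆ H}

/-! Let q be the order of `K`, let L be the line in S, and let W be a plane over `K` through L. The
key bound is that S has at most (d-1)q rational points in W off L. Suppose there are at least that
many, and let P be one of them. Each of the q+1 lines through P in W meets L in a point of S, so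
such a line, if not contained in S, carries at most d-2 further points of S off L, and a tangent
line at P carries fewer still. If no line through P in W lay in S, there would be fewer than 1 +
(q+1)(d-2) points, which is at most (d-1)q because d ≤ q+1, a contradiction
(`exists_linePoly_eq_zero`). Hence every such P lies on a line of S in W other than L.

Since no plane over `K` is a component, W contains at most d lines of S (`card_lines_aux`). Besides
L there are at most d-1, each with q rational points off L, which proves the bound. Equality forces
exactly d lines, no two meeting off L, so all pass through one point of L (`exists_vertex`). The d
lines then exhaust the section even over the algebraic closure. The prescribed number of points is
the one for which all planes through L attain the bound (`card_fiberZeros_eq`).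

For the bijection, vertices are compared with points of tangency. W is tangent at its vertex, where
it contains two lines of S. Conversely, if W is tangent at u in L, a second count, over the lines of
W through u, yields a line of S through u other than L, so u is the vertex
(`exists_smul_eq_of_gradFun`). Every point of L has a tangent plane through L, which gives
surjectivity. If two planes share a vertex v, the differential vanishes at v, so every plane through
L is tangent at v and has vertex v; the tangent plane at another point of L contradicts this
(`eq_of_common_vertex`). -/

open Polynomial in
/-- The univariate polynomial `F(u + t v)` in `t`. -/
noncomputable def linePoly {σ R A : Type*} [CommRing R] [CommRing A] [Algebra R A]
    (F : MvPolynomial σ R) (u v : σ → A) : A[X] :=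
  MvPolynomial.aeval (fun i => C (u i) + C (v i) * X) F

/-! ### Restriction of a form to a parametrized line -/

section LinePoly

open Polynomial

variable {σ R A : Type*} [CommRing R] [CommRing A] [Algebra R A]

theorem eval_linePoly (F : MvPolynomial σ R) (u v : σ → A) (t : A) :
    (linePoly F u v).eval t = MvPolynomial.aeval (u + t • v) F := by
  have h := MvPolynomial.comp_aeval_apply (fun i => C (u i) + C (v i) * X)
    ((Polynomial.aeval t).restrictScalars R) F
  simp only [AlgHom.restrictScalars_apply, Polynomial.coe_aeval_eq_eval] at h
  rw [linePoly, h]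
  congr 2
  funext i
  simp only [eval_add, eval_C, eval_mul, eval_X, Pi.add_apply, Pi.smul_apply, smul_eq_mul]
  ring

theorem coeff_zero_linePoly (F : MvPolynomial σ R) (u v : σ → A) :
    (linePoly F u v).coeff 0 = MvPolynomial.aeval u F := by
  rw [coeff_zero_eq_eval_zero, eval_linePoly, zero_smul, add_zero]

theorem map_linePoly {B : Type*} [CommRing B] [Algebra R B] [Algebra A B] [IsScalarTower R A B]
    (F : MvPolynomial σ R) (u v : σ → A) :
    (linePoly F u v).map (algebraMap A B) =
      linePoly F (fun i => algebraMap A B (u i)) (fun i => algebraMap A B (v i)) := by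
  have h := MvPolynomial.comp_aeval_apply (fun i => C (u i) + C (v i) * X)
    ((Polynomial.mapAlg A B).restrictScalars R) F
  simp only [AlgHom.restrictScalars_apply, Polynomial.mapAlg_eq_map] at h
  rw [linePoly, h, linePoly]
  congr 2
  funext i
  simp

theorem reflect_prod {ι : Type*} (s : Finset ι) (f : ι → A[X]) (N : ι → ℕ)
    (h : ∀ i ∈ s, (f i).natDegree ≤ N i) :
    reflect (∑ i ∈ s, N i) (∏ i ∈ s, f i) = ∏ i ∈ s, reflect (N i) (f i) := by
  classical
  induction s using Finset.induction_on with
  | empty => simp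
  | insert a s ha ih =>
    rw [Finset.sum_insert ha, Finset.prod_insert ha, Finset.prod_insert ha, reflect_mul,
      ih fun i hi => h i (Finset.mem_insert_of_mem hi)]
    · exact h a (Finset.mem_insert_self _ _)
    · exact (natDegree_prod_le _ _).trans
        (Finset.sum_le_sum fun i hi => h i (Finset.mem_insert_of_mem hi))

theorem natDegree_C_add_le (a b : A) : (C a + C b * X).natDegree ≤ 1 := by
  rw [add_comm]
  exact natDegree_linear_le

theorem reflect_linear_pow (a b : A) (n : ℕ) :
    reflect n ((C a + C b * X) ^ n) = (C b + C a * X) ^ n := by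
  have h := reflect_prod (Finset.range n) (fun _ => C a + C b * X) (fun _ => 1)
    fun _ _ => natDegree_C_add_le a b
  have h1 : reflect 1 (C a + C b * X) = C b + C a * X := by
    have h2 : reflect 1 (C b * X) = C b := by simp
    rw [reflect_add, reflect_C, h2, pow_one, add_comm]
  simp only [Finset.prod_const, Finset.card_range, h1, Finset.sum_const, smul_eq_mul, mul_one] at h
  exact h

/-- Homogeneity gives t^d F(u + t⁻¹v) = F(v + tu); it is checked monomial by monomial. This gives
access to the behaviour at the point at infinity v of the line: its value and differential are the
coefficients of index d and d-1. -/
theorem reflect_linePoly {F : MvPolynomial σ R} {d : ℕ} (hF : F.IsHomogeneous d) (u v : σ → A) :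
    reflect d (linePoly F u v) = linePoly F v u := by
  have key : ∀ m ∈ F.support,
      reflect d (MvPolynomial.aeval (fun i => C (u i) + C (v i) * X)
        (MvPolynomial.monomial m (F.coeff m))) =
      MvPolynomial.aeval (fun i => C (v i) + C (u i) * X)
        (MvPolynomial.monomial m (F.coeff m)) := by
    intro m hm
    have hd : ∑ i ∈ m.support, m i = d := by
      have := hF (MvPolynomial.mem_support_iff.mp hm)
      rw [← this, Finsupp.weight_apply, Finsupp.sum]
      simp
    rw [MvPolynomial.aeval_monomial, MvPolynomial.aeval_monomial]
    change reflect d (C (algebraMap R A _) * _) = C (algebraMap R A _) * _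
    rw [reflect_C_mul, Finsupp.prod, Finsupp.prod, ← hd, reflect_prod]
    · simp only [reflect_linear_pow]
    · intro i _
      exact (natDegree_pow_le).trans ((Nat.mul_le_mul_left _ (natDegree_C_add_le _ _)).trans
        (by simp))
  have hsum : ∀ (s : Finset (σ →₀ ℕ)) (f : (σ →₀ ℕ) → A[X]),
      reflect d (∑ m ∈ s, f m) = ∑ m ∈ s, reflect d (f m) := by
    classical
    intro s f
    induction s using Finset.induction_on with
    | empty => simp
    | insert a s ha ih => rw [Finset.sum_insert ha, Finset.sum_insert ha, reflect_add, ih]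
  unfold linePoly
  conv_lhs => rw [F.as_sum]
  conv_rhs => rw [F.as_sum]
  rw [map_sum, map_sum, hsum]
  exact Finset.sum_congr rfl key

theorem natDegree_linePoly_le {F : MvPolynomial σ R} {d : ℕ} (hF : F.IsHomogeneous d)
    (u v : σ → A) : (linePoly F u v).natDegree ≤ d := by
  have h := MvPolynomial.aeval_natDegree_le (MvPolynomial.map (algebraMap R A) F)
    (hF.map (algebraMap R A)).totalDegree_le
    (fun i => C (u i) + C (v i) * X) (fun i => natDegree_C_add_le (u i) (v i))
  rw [mul_one, MvPolynomial.aeval_map_algebraMap] at h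
  exact h

theorem coeff_linePoly_sub {F : MvPolynomial σ R} {d : ℕ} (hF : F.IsHomogeneous d)
    (u v : σ → A) {n : ℕ} (hn : n ≤ d) :
    (linePoly F u v).coeff (d - n) = (linePoly F v u).coeff n := by
  rw [← reflect_linePoly hF u v, coeff_reflect, revAt_le hn]

theorem coeff_linePoly {F : MvPolynomial σ R} {d : ℕ} (hF : F.IsHomogeneous d)
    (u v : σ → A) : (linePoly F u v).coeff d = MvPolynomial.aeval v F := by
  simpa [coeff_zero_linePoly] using coeff_linePoly_sub hF u v (Nat.zero_le d)

/-- This is the chain rule; it serves to make the linear coefficient a linear functional of v. -/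
theorem coeff_one_linePoly [Fintype σ] (F : MvPolynomial σ R) (u v : σ → A) :
    (linePoly F u v).coeff 1 = ∑ i, v i * MvPolynomial.aeval u (MvPolynomial.pderiv i F) := by
  classical
  induction F using MvPolynomial.induction_on with
  | C a =>
    have : linePoly (MvPolynomial.C a) u v = C (algebraMap R A a) := by
      simp [linePoly, MvPolynomial.algHom_C]
    rw [this, coeff_C]
    simp
  | add p q hp hq =>
    have : linePoly (p + q) u v = linePoly p u v + linePoly q u v := by simp [linePoly]
    rw [this, coeff_add, hp, hq, ← Finset.sum_add_distrib]
    exact Finset.sum_congr rfl fun i _ => by simp [mul_add]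
  | mul_X p n hp =>
    have : linePoly (p * MvPolynomial.X n) u v = linePoly p u v * (C (u n) + C (v n) * X) := by
      simp [linePoly]
    rw [this, mul_coeff_one, hp, coeff_zero_linePoly, Finset.sum_mul]
    have h2 : ∀ i, v i * MvPolynomial.aeval u (MvPolynomial.pderiv i (p * MvPolynomial.X n)) =
        v i * MvPolynomial.aeval u (MvPolynomial.pderiv i p) * u n +
          (if n = i then v n * MvPolynomial.aeval u p else 0) := by
      intro i
      rw [Derivation.leibniz, MvPolynomial.pderiv_X]
      by_cases h : n = i
      · subst h; simp; ring
      · simp [h, mul_comm, mul_left_comm]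
    simp_rw [h2]
    rw [Finset.sum_add_distrib]
    simp [coeff_X]
    ring

theorem degree_linePoly_lt {F : MvPolynomial σ R} {d : ℕ} (hF : F.IsHomogeneous d)
    (u v : σ → A) (hv : MvPolynomial.aeval v F = 0) : (linePoly F u v).degree < d := by
  rw [degree_lt_iff_coeff_zero]
  intro m hm
  rcases hm.eq_or_lt with rfl | hm
  · rw [coeff_linePoly hF, hv]
  · exact coeff_eq_zero_of_natDegree_lt ((natDegree_linePoly_le hF u v).trans_lt hm)

theorem aeval_smul_of_isHomogeneous {F : MvPolynomial σ R} {d : ℕ} (hF : F.IsHomogeneous d)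
    (c : A) (u : σ → A) : MvPolynomial.aeval (c • u) F = c ^ d * MvPolynomial.aeval u F := by
  have h1 := eval_linePoly F 0 u c
  -- Reversing the constant polynomial F(u + t·0) in degree d turns it into F(u)·t^d.
  have h2 : linePoly F 0 u = C (MvPolynomial.aeval u F) * X ^ d := by
    have h : linePoly F u 0 = C (MvPolynomial.aeval u F) := by
      simp only [linePoly, Pi.zero_apply, map_zero, zero_mul, add_zero]
      exact (MvPolynomial.comp_aeval_apply u (Algebra.ofId A A[X] |>.restrictScalars R) F).symm
    rw [← reflect_linePoly hF, h, reflect_C]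
  rw [zero_add, h2] at h1
  rw [← h1, eval_mul, eval_C, eval_pow, eval_X, mul_comm]

end LinePoly

/-! ### Linear forms and vanishing on hyperplanes -/

/-- The linear form with the values of the functional `φ`. -/
noncomputable def linForm {σ k : Type*} [Fintype σ] [DecidableEq σ] [Field k]
    (φ : (σ → k) →ₗ[k] k) : MvPolynomial σ k :=
  ∑ i, MvPolynomial.C (φ (Pi.single i 1)) * MvPolynomial.X i

section Hyperplanes

variable {σ k : Type*} [Fintype σ] [DecidableEq σ] [Field k]

theorem apply_eq_sum_single (φ : (σ → k) →ₗ[k] k) (x : σ → k) :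
    φ x = ∑ i, φ (Pi.single i 1) * x i := by
  conv_lhs => rw [pi_eq_sum_univ' x]
  rw [map_sum]
  refine Finset.sum_congr rfl fun i _ => ?_
  rw [map_smul, smul_eq_mul, mul_comm]

theorem aeval_linForm (φ : (σ → k) →ₗ[k] k) (x : σ → k) :
    MvPolynomial.aeval x (linForm φ) = φ x := by
  rw [apply_eq_sum_single φ x]
  simp [linForm]

theorem linForm_isHomogeneous (φ : (σ → k) →ₗ[k] k) : (linForm φ).IsHomogeneous 1 :=
  MvPolynomial.IsHomogeneous.sum _ _ _ fun i _ => by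
    simpa using (MvPolynomial.isHomogeneous_C σ (φ (Pi.single i 1))).mul
      (MvPolynomial.isHomogeneous_X k i)

theorem linForm_ne_zero {φ : (σ → k) →ₗ[k] k} {x : σ → k} (h : φ x ≠ 0) : linForm φ ≠ 0 := by
  intro h0
  apply h
  rw [← aeval_linForm, h0, map_zero]

theorem exists_aeval_ne_zero {σ k : Type*} [Field k] [Infinite k] {G : MvPolynomial σ k} (hG : G ≠ 0) :
    ∃ x : σ → k, MvPolynomial.aeval x G ≠ 0 := by
  by_contra! h
  refine hG (MvPolynomial.funext fun x => ?_)
  simpa using h x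

/-- A form of degree `d` that vanishes on more than `d` hyperplanes, or on `d` hyperplanes and
at a point outside of them, is zero. -/
theorem eq_zero_of_vanishes_on_hyperplanes [Infinite k] {ι : Type*} {G : MvPolynomial σ k} {d : ℕ}
    (hG : G.IsHomogeneous d) (s : Finset ι) (φ : ι → (σ → k) →ₗ[k] k) (Q : σ → k)
    (hQ : ∀ i ∈ s, φ i Q ≠ 0)
    (hdist : ∀ i ∈ s, ∀ j ∈ s, i ≠ j → ∃ x, φ j Q * φ i x - φ i Q * φ j x ≠ 0)
    (hvan : ∀ i ∈ s, ∀ x, φ i x = 0 → MvPolynomial.aeval x G = 0)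
    (hcard : d < s.card ∨ d = s.card ∧ MvPolynomial.aeval Q G = 0) : G = 0 := by
  classical
  by_contra hne
  -- A generic x is chosen with G(x) ≠ 0 such that the line x + tQ meets the hyperplanes at pairwise
  -- distinct parameters -φ_i(x)/φ_i(Q). These parameters are then too many roots for G on that
  -- line.
  have hprod : G * ∏ p ∈ s.offDiag, linForm (φ p.2 Q • φ p.1 - φ p.1 Q • φ p.2) ≠ 0 := by
    refine mul_ne_zero hne (Finset.prod_ne_zero_iff.mpr fun p hp => ?_)
    rw [Finset.mem_offDiag] at hp
    obtain ⟨x, hx⟩ := hdist p.1 hp.1 p.2 hp.2.1 hp.2.2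
    exact linForm_ne_zero (x := x) (by simpa using hx)
  obtain ⟨x, hx⟩ := exists_aeval_ne_zero hprod
  rw [map_mul, map_prod, mul_ne_zero_iff, Finset.prod_ne_zero_iff] at hx
  obtain ⟨hxG, hx⟩ := hx
  refine hxG ?_
  have hdeg : (linePoly G x Q).degree < s.card := by
    rcases hcard with h | ⟨h, hQ0⟩
    · exact (Polynomial.degree_le_of_natDegree_le (natDegree_linePoly_le hG x Q)).trans_lt
        (by exact_mod_cast h)
    · rw [← h]
      exact degree_linePoly_lt hG x Q hQ0
  have hzero : linePoly G x Q = 0 := by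
    refine Polynomial.eq_zero_of_degree_lt_of_eval_index_eq_zero s (v := fun i => -(φ i x / φ i Q))
      ?_ hdeg ?_
    · intro i hi j hj hij
      by_contra hne
      have := hx (i, j) (Finset.mem_offDiag.mpr ⟨hi, hj, hne⟩)
      rw [aeval_linForm] at this
      apply this
      have h1 := hQ i hi
      have h2 := hQ j hj
      simp only [neg_inj] at hij
      field_simp at hij
      simp only [LinearMap.sub_apply, LinearMap.smul_apply, smul_eq_mul]
      linear_combination hij
    · intro i hi
      rw [eval_linePoly]
      refine hvan i hi _ ?_
      have h1 := hQ i hi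
      simp only [map_add, map_smul, smul_eq_mul]
      field_simp
      ring
  rw [← coeff_zero_linePoly G x Q, hzero, Polynomial.coeff_zero]

/-- Composition of `F` with the projection `x ↦ x - ℓ(x) x₀`. -/
noncomputable def compProj (ℓ : (σ → k) →ₗ[k] k) (x₀ : σ → k) (F : MvPolynomial σ k) :
    MvPolynomial σ k :=
  MvPolynomial.aeval (fun i => MvPolynomial.X i - MvPolynomial.C (x₀ i) * linForm ℓ) F

/-- Modulo ℓ the substitution is the identity. So if F composed with the projection vanishes
identically, then ℓ divides F. -/
theorem linForm_dvd_sub_compProj (ℓ : (σ → k) →ₗ[k] k) (x₀ : σ → k) (F : MvPolynomial σ k) :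
    linForm ℓ ∣ F - compProj ℓ x₀ F := by
  rw [← Ideal.mem_span_singleton, ← Ideal.Quotient.eq]
  set I := Ideal.span {linForm ℓ}
  have h1 := MvPolynomial.comp_aeval_apply
    (fun i => MvPolynomial.X i - MvPolynomial.C (x₀ i) * linForm ℓ) (Ideal.Quotient.mkₐ k I) F
  have h2 := MvPolynomial.comp_aeval_apply
    (fun i => (MvPolynomial.X i : MvPolynomial σ k)) (Ideal.Quotient.mkₐ k I) F
  have h3 : Ideal.Quotient.mkₐ k I (linForm ℓ) = 0 :=
    Ideal.Quotient.eq_zero_iff_mem.mpr (Ideal.mem_span_singleton_self _)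
  rw [MvPolynomial.aeval_X_left_apply] at h2
  change Ideal.Quotient.mkₐ k I F = Ideal.Quotient.mkₐ k I (compProj ℓ x₀ F)
  rw [compProj, h1, h2]
  simp only [map_sub, map_mul, h3, mul_zero, sub_zero]

theorem compProj_isHomogeneous (ℓ : (σ → k) →ₗ[k] k) (x₀ : σ → k) {F : MvPolynomial σ k} {d : ℕ}
    (hF : F.IsHomogeneous d) : (compProj ℓ x₀ F).IsHomogeneous d := by
  have h := hF.aeval (n := 1)
    (fun i => MvPolynomial.X i - MvPolynomial.C (x₀ i) * linForm ℓ) fun i => by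
      refine (MvPolynomial.isHomogeneous_X k i).sub ?_
      simpa using (MvPolynomial.isHomogeneous_C σ (x₀ i)).mul (linForm_isHomogeneous ℓ)
  rwa [one_mul] at h

theorem aeval_compProj {A : Type*} [CommRing A] [Algebra k A] (ℓ : (σ → k) →ₗ[k] k) (x₀ : σ → k)
    (F : MvPolynomial σ k) (y : σ → A) :
    MvPolynomial.aeval y (compProj ℓ x₀ F) =
      MvPolynomial.aeval (fun i => y i - algebraMap k A (x₀ i) *
        ∑ j, algebraMap k A (ℓ (Pi.single j 1)) * y j) F := by
  rw [compProj, MvPolynomial.comp_aeval_apply]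
  congr 2
  funext i
  simp [linForm]

end Hyperplanes

/-! ### Subspaces over `K` and their extensions to `K̄` -/

/-- The subspace of `K̄⁴` spanned by a subspace of `K⁴`. -/
noncomputable def ratSpan {K : Type*} [Field K] (W : Submodule K (Fin 4 → K)) :
    Submodule (AlgebraicClosure K) (Fin 4 → AlgebraicClosure K) :=
  Submodule.span (AlgebraicClosure K) (ratVec K '' (W : Set (Fin 4 → K)))

/-- The extension to `K̄⁴` of a functional on `K⁴`. -/
noncomputable def extFun {K : Type*} [Field K] (φ : (Fin 4 → K) →ₗ[K] K) :
    (Fin 4 → AlgebraicClosure K) →ₗ[AlgebraicClosure K] AlgebraicClosure K :=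
  ∑ i, algebraMap K (AlgebraicClosure K) (φ (Pi.single i 1)) • LinearMap.proj i

/-- The form `F` vanishes on `M ⊗ K̄`. -/
def VanishesOn {K : Type*} [Field K] (F : MvPolynomial (Fin 4) K) (M : Submodule K (Fin 4 → K)) :
    Prop :=
  ∀ y ∈ ratSpan M, MvPolynomial.aeval y F = 0

section RatSpan

variable {K : Type*} [Field K]

theorem extFun_apply (φ : (Fin 4 → K) →ₗ[K] K) (y : Fin 4 → AlgebraicClosure K) :
    extFun φ y = ∑ i, algebraMap K (AlgebraicClosure K) (φ (Pi.single i 1)) * y i := by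
  simp [extFun, Algebra.smul_def]

theorem extFun_ratVec (φ : (Fin 4 → K) →ₗ[K] K) (x : Fin 4 → K) :
    extFun φ (ratVec K x) = algebraMap K (AlgebraicClosure K) (φ x) := by
  rw [extFun_apply, apply_eq_sum_single φ x, map_sum]
  exact Finset.sum_congr rfl fun i _ => by rw [map_mul]; rfl

theorem ratVec_mem_of_mem {W : Submodule K (Fin 4 → K)} {x : Fin 4 → K} (hx : x ∈ W) :
    ratVec K x ∈ ratSpan W :=
  Submodule.subset_span ⟨x, hx, rfl⟩

theorem ratSpan_mono {M W : Submodule K (Fin 4 → K)} (h : M ≤ W) : ratSpan M ≤ ratSpan W :=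
  Submodule.span_mono (Set.image_mono h)

theorem extFun_eq_zero {W : Submodule K (Fin 4 → K)} {φ : (Fin 4 → K) →ₗ[K] K}
    (h : ∀ x ∈ W, φ x = 0) {y : Fin 4 → AlgebraicClosure K} (hy : y ∈ ratSpan W) :
    extFun φ y = 0 := by
  have : ratSpan W ≤ LinearMap.ker (extFun φ) := by
    refine Submodule.span_le.mpr ?_
    rintro _ ⟨x, hx, rfl⟩
    simp [extFun_ratVec, h x hx]
  exact this hy

theorem exists_functional_of_notMem {W : Submodule K (Fin 4 → K)} {x : Fin 4 → K} (hx : x ∉ W) :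
    ∃ φ : (Fin 4 → K) →ₗ[K] K, φ x ≠ 0 ∧ ∀ y ∈ W, φ y = 0 := by
  obtain ⟨φ, h1, h2⟩ := Submodule.exists_le_ker_of_notMem hx
  exact ⟨φ, h1, fun y hy => h2 hy⟩

theorem ratVec_mem_ratSpan {W : Submodule K (Fin 4 → K)} {x : Fin 4 → K} :
    ratVec K x ∈ ratSpan W ↔ x ∈ W := by
  refine ⟨fun h => ?_, ratVec_mem_of_mem⟩
  by_contra hx
  obtain ⟨φ, h1, h2⟩ := exists_functional_of_notMem hx
  have := extFun_eq_zero h2 h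
  rw [extFun_ratVec] at this
  exact h1 ((algebraMap K (AlgebraicClosure K)).injective (by rw [this, map_zero]))

theorem ratSpan_sup (M N : Submodule K (Fin 4 → K)) :
    ratSpan (M ⊔ N) = ratSpan M ⊔ ratSpan N := by
  refine le_antisymm (Submodule.span_le.mpr ?_)
    (sup_le (ratSpan_mono le_sup_left) (ratSpan_mono le_sup_right))
  rintro _ ⟨x, hx, rfl⟩
  obtain ⟨m, hm, n, hn, rfl⟩ := Submodule.mem_sup.mp hx
  rw [map_add]
  exact Submodule.add_mem_sup (ratVec_mem_of_mem hm) (ratVec_mem_of_mem hn)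

theorem ratSpan_singleton (x : Fin 4 → K) :
    ratSpan (K ∙ x) = Submodule.span (AlgebraicClosure K) {ratVec K x} := by
  refine le_antisymm (Submodule.span_le.mpr ?_) (Submodule.span_le.mpr ?_)
  · rintro _ ⟨y, hy, rfl⟩
    obtain ⟨c, rfl⟩ := Submodule.mem_span_singleton.mp hy
    rw [map_smulₛₗ]
    exact Submodule.smul_mem _ _ (Submodule.mem_span_singleton_self _)
  · rintro _ rfl
    exact ratVec_mem_of_mem (Submodule.mem_span_singleton_self x)

theorem mem_ratSpan_pair {x y : Fin 4 → K} {z : Fin 4 → AlgebraicClosure K} :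
    z ∈ ratSpan (Submodule.span K {x, y}) ↔
      ∃ a b : AlgebraicClosure K, a • ratVec K x + b • ratVec K y = z := by
  rw [Submodule.span_insert, ratSpan_sup, ratSpan_singleton, ratSpan_singleton,
    ← Submodule.span_insert, Submodule.mem_span_pair]

theorem aeval_ratVec (F : MvPolynomial (Fin 4) K) (x : Fin 4 → K) :
    MvPolynomial.aeval (ratVec K x) F =
      algebraMap K (AlgebraicClosure K) (MvPolynomial.aeval x F) := by
  have h := MvPolynomial.aeval_algebraMap_apply (AlgebraicClosure K) x F
  exact h

theorem VanishesOn.mono {F : MvPolynomial (Fin 4) K} {M W : Submodule K (Fin 4 → K)}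
    (h : VanishesOn F W) (hMW : M ≤ W) : VanishesOn F M :=
  fun y hy => h y (ratSpan_mono hMW hy)

theorem VanishesOn.aeval_eq_zero {F : MvPolynomial (Fin 4) K} {M : Submodule K (Fin 4 → K)}
    (h : VanishesOn F M) {x : Fin 4 → K} (hx : x ∈ M) : MvPolynomial.aeval x F = 0 := by
  have := h _ (ratVec_mem_of_mem hx)
  rw [aeval_ratVec] at this
  exact (algebraMap K (AlgebraicClosure K)).injective (by rw [this, map_zero])

/-- The field `K̄` is infinite, so vanishing at all x + ty is a polynomial identity, whereas
rational values alone would not suffice. The missing point y at infinity is the coefficient of index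
d. -/
theorem vanishesOn_span_pair_iff {F : MvPolynomial (Fin 4) K} {d : ℕ} (hF : F.IsHomogeneous d)
    (x y : Fin 4 → K) :
    VanishesOn F (Submodule.span K {x, y}) ↔ linePoly F x y = 0 := by
  have hmap : (linePoly F x y).map (algebraMap K (AlgebraicClosure K)) =
      linePoly F (ratVec K x) (ratVec K y) := map_linePoly F x y
  constructor
  · intro h
    apply Polynomial.map_injective _ (algebraMap K (AlgebraicClosure K)).injective
    rw [hmap, Polynomial.map_zero]
    refine Polynomial.funext fun t => ?_
    rw [eval_linePoly, Polynomial.eval_zero]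
    exact h _ (mem_ratSpan_pair.mpr ⟨1, t, by rw [one_smul]⟩)
  · intro h z hz
    rw [h, Polynomial.map_zero] at hmap
    obtain ⟨a, b, rfl⟩ := mem_ratSpan_pair.mp hz
    by_cases ha : a = 0
    · rw [ha, zero_smul, zero_add, aeval_smul_of_isHomogeneous hF,
        ← coeff_linePoly hF (ratVec K x), ← hmap, Polynomial.coeff_zero, mul_zero]
    · have : a • ratVec K x + b • ratVec K y = a • (ratVec K x + (b / a) • ratVec K y) := by
        rw [smul_add, smul_smul, mul_div_cancel₀ _ ha]
      rw [this, aeval_smul_of_isHomogeneous hF, ← eval_linePoly, ← hmap, Polynomial.eval_zero,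
        mul_zero]

theorem exists_notMem_of_finrank_lt {M W : Submodule K (Fin 4 → K)}
    (h : Module.finrank K M < Module.finrank K W) : ∃ x ∈ W, x ∉ M := by
  by_contra! hle
  exact absurd (Submodule.finrank_mono (show W ≤ M from hle)) (by omega)

theorem sup_span_singleton_eq {M W : Submodule K (Fin 4 → K)} (hMW : M ≤ W)
    (h : Module.finrank K W = Module.finrank K M + 1) {x : Fin 4 → K} (hx : x ∈ W) (hxM : x ∉ M) :
    M ⊔ K ∙ x = W := by
  refine Submodule.eq_of_le_of_finrank_le
    (sup_le hMW ((Submodule.span_singleton_le_iff_mem x W).mpr hx)) ?_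
  rw [h]
  refine Submodule.finrank_lt_finrank_of_lt (lt_of_le_of_ne le_sup_left fun he => hxM ?_)
  rw [he]
  exact le_sup_right (a := M) (Submodule.mem_span_singleton_self x)

theorem exists_add_smul_eq {M W : Submodule K (Fin 4 → K)} (hMW : M ≤ W)
    (h : Module.finrank K W = Module.finrank K M + 1) {x : Fin 4 → K} (hx : x ∈ W) (hxM : x ∉ M)
    {y : Fin 4 → K} (hy : y ∈ W) : ∃ m ∈ M, ∃ c : K, m + c • x = y := by
  rw [← sup_span_singleton_eq hMW h hx hxM] at hy
  obtain ⟨m, hm, n, hn, rfl⟩ := Submodule.mem_sup.mp hy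
  obtain ⟨c, rfl⟩ := Submodule.mem_span_singleton.mp hn
  exact ⟨m, hm, c, rfl⟩

/-- A hyperplane of `W` is cut out by a functional, over `K` and over `K̄`. -/
theorem exists_functional_cutting {M W : Submodule K (Fin 4 → K)} (hMW : M ≤ W)
    (h : Module.finrank K W = Module.finrank K M + 1) :
    ∃ φ : (Fin 4 → K) →ₗ[K] K, (∀ x ∈ W, φ x = 0 ↔ x ∈ M) ∧
      ∀ y ∈ ratSpan W, extFun φ y = 0 ↔ y ∈ ratSpan M := by
  obtain ⟨x, hx, hxM⟩ := exists_notMem_of_finrank_lt (M := M) (W := W) (by omega)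
  obtain ⟨φ, h1, h2⟩ := exists_functional_of_notMem hxM
  refine ⟨φ, fun y hy => ⟨fun h0 => ?_, h2 y⟩, fun y hy => ⟨fun h0 => ?_, extFun_eq_zero h2⟩⟩
  · obtain ⟨m, hm, c, rfl⟩ := exists_add_smul_eq hMW h hx hxM hy
    rw [map_add, h2 m hm, map_smul, zero_add, smul_eq_mul, mul_eq_zero] at h0
    rw [h0.resolve_right h1, zero_smul, add_zero]
    exact hm
  · rw [← sup_span_singleton_eq hMW h hx hxM, ratSpan_sup, ratSpan_singleton] at hy
    obtain ⟨m, hm, n, hn, rfl⟩ := Submodule.mem_sup.mp hy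
    obtain ⟨c, rfl⟩ := Submodule.mem_span_singleton.mp hn
    rw [map_add, extFun_eq_zero h2 hm, map_smul, zero_add, extFun_ratVec, smul_eq_mul,
      mul_eq_zero] at h0
    have h3 : algebraMap K (AlgebraicClosure K) (φ x) ≠ 0 := by simpa using h1
    rw [h0.resolve_right h3, zero_smul, add_zero]
    exact hm

/-! ### Lines of the surface in a plane -/

/-- The projection of `K̄⁴` along `x₀` to the zero set of the functional `ℓ`. -/
noncomputable def extProj (ℓ : (Fin 4 → K) →ₗ[K] K) (x₀ : Fin 4 → K) :
    (Fin 4 → AlgebraicClosure K) →ₗ[AlgebraicClosure K] (Fin 4 → AlgebraicClosure K) :=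
  LinearMap.id - (extFun ℓ).smulRight (ratVec K x₀)

theorem extProj_apply (ℓ : (Fin 4 → K) →ₗ[K] K) (x₀ : Fin 4 → K)
    (y : Fin 4 → AlgebraicClosure K) : extProj ℓ x₀ y = y - extFun ℓ y • ratVec K x₀ := by
  simp [extProj]

/-- Lines over `K` in a plane `W` over `K`, on all of which `F` vanishes, are at most `d` in
number; if there are `d` of them, then they contain all zeros of `F` in `W`. -/
theorem card_lines_aux {F : MvPolynomial (Fin 4) K} {d : ℕ} (hF : F.IsHomogeneous d)
    (hplane : HasNoPlaneComponent F) {W : Submodule K (Fin 4 → K)} (hW : Module.finrank K W = 3)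
    (s : Finset (Submodule K (Fin 4 → K)))
    (hs : ∀ M ∈ s, M ≤ W ∧ Module.finrank K M = 2 ∧ VanishesOn F M) :
    s.card ≤ d ∧ (s.card = d → ∀ y ∈ ratSpan W, MvPolynomial.aeval y F = 0 →
      ∃ M ∈ s, y ∈ ratSpan M) := by
  classical
  obtain ⟨ℓ₀, hℓ₀, hℓ₀'⟩ := exists_functional_cutting (le_top : W ≤ ⊤) (by simp [hW])
  obtain ⟨x₁, -, hx₁⟩ := exists_notMem_of_finrank_lt (M := W) (W := ⊤) (by simp [hW])
  have hx₁' : ℓ₀ x₁ ≠ 0 := fun h => hx₁ ((hℓ₀ x₁ trivial).mp h)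
  set x₀ := (ℓ₀ x₁)⁻¹ • x₁ with hx₀
  have hℓx : ℓ₀ x₀ = 1 := by rw [hx₀, map_smul, smul_eq_mul, inv_mul_cancel₀ hx₁']
  have htop : ∀ y : Fin 4 → AlgebraicClosure K, y ∈ ratSpan (⊤ : Submodule K (Fin 4 → K)) := by
    intro y
    rw [pi_eq_sum_univ' y]
    refine Submodule.sum_mem _ fun i _ => Submodule.smul_mem _ _ ?_
    have : (Pi.single i 1 : Fin 4 → AlgebraicClosure K) = ratVec K (Pi.single i 1) := by
      funext j
      simp [ratVec, Pi.single_apply, apply_ite]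
    rw [this]
    exact ratVec_mem_of_mem trivial
  have hprojmem : ∀ y, extProj ℓ₀ x₀ y ∈ ratSpan W := by
    intro y
    refine (hℓ₀' _ (htop _)).mp ?_
    rw [extProj_apply, map_sub, map_smul, extFun_ratVec, hℓx]
    simp
  have hprojid : ∀ y ∈ ratSpan W, extProj ℓ₀ x₀ y = y := by
    intro y hy
    rw [extProj_apply, (hℓ₀' _ (htop _)).mpr hy]
    simp
  -- G is the cone over the section of F by W, with apex x₀. Lines of W become hyperplanes through
  -- x₀, so the hyperplane lemma applies to a form in four variables without coordinates on W.
  set G := MvPolynomial.map (algebraMap K (AlgebraicClosure K)) (compProj ℓ₀ x₀ F) with hGdef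
  have hG : G.IsHomogeneous d := (compProj_isHomogeneous ℓ₀ x₀ hF).map _
  have hGe : ∀ y, MvPolynomial.aeval y G = MvPolynomial.aeval (extProj ℓ₀ x₀ y) F := by
    intro y
    rw [hGdef, MvPolynomial.aeval_map_algebraMap, aeval_compProj]
    congr 2
    funext i
    rw [extProj_apply, extFun_apply]
    simp [ratVec, mul_comm]
  have hG0 : G ≠ 0 := by
    intro h0
    have h1 : compProj ℓ₀ x₀ F = 0 :=
      MvPolynomial.map_injective _ (algebraMap K (AlgebraicClosure K)).injective
        (by rw [← hGdef, h0, map_zero])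
    have h2 := linForm_dvd_sub_compProj ℓ₀ x₀ F
    rw [h1, sub_zero] at h2
    exact hplane _ (linForm_ne_zero (x := x₀) (by rw [hℓx]; exact one_ne_zero))
      (linForm_isHomogeneous ℓ₀) h2
  have hex : ∀ M : Submodule K (Fin 4 → K), ∃ φ : (Fin 4 → K) →ₗ[K] K, M ∈ s →
      (∀ x ∈ W, φ x = 0 ↔ x ∈ M) ∧ ∀ y ∈ ratSpan W, extFun φ y = 0 ↔ y ∈ ratSpan M := by
    intro M
    by_cases hM : M ∈ s
    · obtain ⟨φ, h⟩ := exists_functional_cutting (hs M hM).1 (by rw [hW, (hs M hM).2.1])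
      exact ⟨φ, fun _ => h⟩
    · exact ⟨0, fun h => absurd h hM⟩
  choose φ hφ using hex
  have key : ∀ Q, (∀ M ∈ s, extFun (φ M) (extProj ℓ₀ x₀ Q) ≠ 0) →
      ¬ (d < s.card ∨ d = s.card ∧ MvPolynomial.aeval Q G = 0) := by
    intro Q hQ hcard
    refine hG0 (eq_zero_of_vanishes_on_hyperplanes hG s
      (fun M => extFun (φ M) ∘ₗ extProj ℓ₀ x₀) Q hQ ?_ ?_ hcard)
    · intro M hM N hN hne
      have : ∃ x ∈ M, x ∉ N := by
        by_contra! hle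
        exact hne (Submodule.eq_of_le_of_finrank_eq hle (by rw [(hs M hM).2.1, (hs N hN).2.1]))
      obtain ⟨x, hxM, hxN⟩ := this
      have hxW := (hs M hM).1 hxM
      refine ⟨ratVec K x, ?_⟩
      simp only [LinearMap.comp_apply, hprojid _ (ratVec_mem_of_mem hxW)]
      rw [((hφ M hM).2 _ (ratVec_mem_of_mem hxW)).mpr (ratVec_mem_of_mem hxM), mul_zero, zero_sub]
      refine neg_ne_zero.mpr (mul_ne_zero (hQ M hM) fun h0 => hxN ?_)
      exact ratVec_mem_ratSpan.mp (((hφ N hN).2 _ (ratVec_mem_of_mem hxW)).mp h0)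
    · intro M hM x hx
      rw [hGe]
      exact (hs M hM).2.2 _ (((hφ M hM).2 _ (hprojmem x)).mp hx)
  constructor
  · by_contra! hlt
    have hprod : ∏ M ∈ s, linForm (extFun (φ M) ∘ₗ extProj ℓ₀ x₀) ≠ 0 := by
      refine Finset.prod_ne_zero_iff.mpr fun M hM => ?_
      obtain ⟨x, hxW, hxM⟩ := exists_notMem_of_finrank_lt (M := M) (W := W)
        (by rw [hW, (hs M hM).2.1]; norm_num)
      refine linForm_ne_zero (x := ratVec K x) ?_
      rw [LinearMap.comp_apply, hprojid _ (ratVec_mem_of_mem hxW)]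
      intro h0
      exact hxM (ratVec_mem_ratSpan.mp (((hφ M hM).2 _ (ratVec_mem_of_mem hxW)).mp h0))
    -- With more than d lines, any Q off all the hyperplanes will do; in the second claim the
    -- uncovered zero y itself plays this role.
    obtain ⟨Q, hQ⟩ := exists_aeval_ne_zero hprod
    rw [map_prod, Finset.prod_ne_zero_iff] at hQ
    refine key Q (fun M hM => ?_) (Or.inl hlt)
    simpa [aeval_linForm] using hQ M hM
  · intro hcard y hy hy0
    by_contra! hne
    refine key y (fun M hM h0 => hne M hM ?_) (Or.inr ⟨hcard.symm, ?_⟩)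
    · rw [hprojid y hy] at h0
      exact ((hφ M hM).2 y hy).mp h0
    · rw [hGe, hprojid y hy, hy0]

end RatSpan

/-! ### Root counts -/

section Roots

open Polynomial

theorem card_add_lt_of_roots {k : Type*} [Field k] {p : k[X]} (hp : p ≠ 0) {d e : ℕ}
    (hdeg : p.degree < d) (he : X ^ e ∣ p) (s : Finset k) (hs : ∀ t ∈ s, t ≠ 0 ∧ p.eval t = 0) :
    s.card + e < d := by
  classical
  obtain ⟨g, rfl⟩ := he
  have hg : g ≠ 0 := right_ne_zero_of_mul hp
  have h1 : s ⊆ g.roots.toFinset := by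
    intro t ht
    obtain ⟨h0, h⟩ := hs t ht
    rw [eval_mul, eval_pow, eval_X, mul_eq_zero] at h
    rw [Multiset.mem_toFinset, mem_roots hg]
    exact h.resolve_left (pow_ne_zero _ h0)
  have h2 : s.card ≤ g.natDegree :=
    (Finset.card_le_card h1).trans ((Multiset.toFinset_card_le _).trans (card_roots' g))
  have h3 : (X ^ e * g).natDegree = e + g.natDegree := by
    rw [natDegree_mul (pow_ne_zero _ X_ne_zero) hg, natDegree_X_pow]
  have h4 : (X ^ e * g).natDegree < d := by
    rwa [natDegree_lt_iff_degree_lt hp]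
  omega

theorem card_lt_of_roots {k : Type*} [Field k] {p : k[X]} (hp : p ≠ 0) {d : ℕ}
    (hdeg : p.degree < d) (s : Finset k) (hs : ∀ t ∈ s, p.eval t = 0) : s.card < d := by
  by_contra! h
  exact hp (eq_zero_of_degree_lt_of_eval_finset_eq_zero s
    (hdeg.trans_le (by exact_mod_cast h)) hs)

end Roots

/-! ### The differential -/

/-- The differential of `F` at `u`. -/
noncomputable def gradFun {K : Type*} [Field K] (F : MvPolynomial (Fin 4) K) (u : Fin 4 → K) :
    (Fin 4 → K) →ₗ[K] K where
  toFun v := (linePoly F u v).coeff 1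
  map_add' v w := by
    simp only [coeff_one_linePoly, Pi.add_apply, add_mul, Finset.sum_add_distrib]
  map_smul' c v := by
    simp only [coeff_one_linePoly, Pi.smul_apply, smul_eq_mul, mul_assoc, Finset.mul_sum,
      RingHom.id_apply]

theorem gradFun_apply {K : Type*} [Field K] (F : MvPolynomial (Fin 4) K) (u v : Fin 4 → K) :
    gradFun F u v = (linePoly F u v).coeff 1 := rfl

/-- The line is tangent at its point at infinity v, so v counts as a double zero and the two top
coefficients vanish. -/
theorem degree_linePoly_lt_pred {K : Type*} [Field K] {F : MvPolynomial (Fin 4) K} {d : ℕ}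
    (hd : 2 ≤ d) (hF : F.IsHomogeneous d) (u v : Fin 4 → K) (hv : MvPolynomial.aeval v F = 0)
    (hg : gradFun F v u = 0) : (linePoly F u v).degree < (d - 1 : ℕ) := by
  rw [Polynomial.degree_lt_iff_coeff_zero]
  intro m hm
  rcases hm.eq_or_lt with rfl | hm
  · rw [coeff_linePoly_sub hF u v (by omega)]
    exact hg
  · exact (Polynomial.degree_lt_iff_coeff_zero _ _).mp (degree_linePoly_lt hF u v hv) m (by omega)

/-! ### Dimension counts -/

section Subspaces

variable {K : Type*} [Field K]

theorem exists_mem_ker_of_finrank {M : Submodule K (Fin 4 → K)} (hM : 2 ≤ Module.finrank K M)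
    (φ : (Fin 4 → K) →ₗ[K] K) : ∃ u ∈ M, u ≠ 0 ∧ φ u = 0 := by
  have h : (φ.domRestrict M).ker ≠ ⊥ :=
    LinearMap.ker_ne_bot_of_finrank_lt (by rw [Module.finrank_self]; omega)
  obtain ⟨x, hx, hx0⟩ := Submodule.exists_mem_ne_zero_of_ne_bot h
  exact ⟨x, x.2, fun h => hx0 (Subtype.ext h), hx⟩

theorem finrank_inf_eq_one {M N W : Submodule K (Fin 4 → K)} (hM : M ≤ W) (hN : N ≤ W)
    (hW : Module.finrank K W = 3) (hM2 : Module.finrank K M = 2) (hN2 : Module.finrank K N = 2)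
    (hne : M ≠ N) : Module.finrank K (M ⊓ N : Submodule K (Fin 4 → K)) = 1 := by
  have h1 := Submodule.finrank_sup_add_finrank_inf_eq M N
  have h2 := Submodule.finrank_mono (sup_le hM hN)
  have h3 := Submodule.finrank_mono (inf_le_left : M ⊓ N ≤ M)
  have h4 : Module.finrank K (M ⊓ N : Submodule K (Fin 4 → K)) ≠ 2 := by
    intro h
    have e1 : M ⊓ N = M := Submodule.eq_of_le_of_finrank_eq inf_le_left (by rw [h, hM2])
    have e2 : M ⊓ N = N := Submodule.eq_of_le_of_finrank_eq inf_le_right (by rw [h, hN2])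
    exact hne (e1.symm.trans e2)
  omega

theorem exists_smul_eq_of_finrank_one {M : Submodule K (Fin 4 → K)}
    (hM : Module.finrank K M = 1) {v : Fin 4 → K} (hv : v ∈ M) (hv0 : v ≠ 0) {x : Fin 4 → K}
    (hx : x ∈ M) : ∃ c : K, c • v = x := by
  obtain ⟨c, hc⟩ := (finrank_eq_one_iff_of_nonzero' (⟨v, hv⟩ : M)
    (fun h => hv0 (congrArg Subtype.val h))).mp hM ⟨x, hx⟩
  exact ⟨c, congrArg Subtype.val hc⟩

theorem finrank_span_pair_of_notMem {L : Submodule K (Fin 4 → K)} {x u : Fin 4 → K}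
    (hu : u ∈ L) (hu0 : u ≠ 0) (hx : x ∉ L) :
    Module.finrank K (Submodule.span K {x, u}) = 2 := by
  have h : LinearIndependent K ![x, u] := by
    rw [LinearIndependent.pair_iff]
    intro a b hab
    have ha : a = 0 := by
      by_contra ha
      refine hx ?_
      have : x = (-(a⁻¹ * b)) • u := by
        have h2 : a⁻¹ • (a • x + b • u) = 0 := by rw [hab, smul_zero]
        rw [smul_add, smul_smul, smul_smul, inv_mul_cancel₀ ha, one_smul] at h2
        rw [neg_smul]
        exact eq_neg_of_add_eq_zero_left h2
      rw [this]
      exact L.smul_mem _ hu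
    rw [ha, zero_smul, zero_add] at hab
    exact ⟨ha, (smul_eq_zero.mp hab).resolve_right hu0⟩
  have h2 := finrank_span_eq_card h
  rwa [Matrix.range_cons, Matrix.range_cons, Matrix.range_empty, Set.union_empty,
    Set.singleton_union, Fintype.card_fin] at h2

theorem finrank_sup_span_singleton {L : Submodule K (Fin 4 → K)} {x : Fin 4 → K} (hx : x ∉ L) :
    Module.finrank K (L ⊔ K ∙ x : Submodule K (Fin 4 → K)) = Module.finrank K L + 1 := by
  have hx0 : x ≠ 0 := fun h => hx (h ▸ L.zero_mem)
  have h1 := Submodule.finrank_sup_add_finrank_inf_eq L (K ∙ x)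
  have h2 : L ⊓ K ∙ x = ⊥ := by
    rw [eq_bot_iff]
    intro y hy
    obtain ⟨hyL, hyx⟩ := Submodule.mem_inf.mp hy
    obtain ⟨c, rfl⟩ := Submodule.mem_span_singleton.mp hyx
    by_cases hc : c = 0
    · simp [hc]
    · exact absurd ((L.smul_mem_iff hc).mp hyL) hx
  rw [h2, finrank_bot, finrank_span_singleton hx0] at h1
  omega

end Subspaces

/-! ### Rational points of a plane section off the line -/

section Counting

open scoped Classical

variable {K : Type*} [Field K] [Fintype K]

/-- The zeros of `F` in the affine plane `w + L`, translated to `L`. -/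
noncomputable def fiberZeros (F : MvPolynomial (Fin 4) K) (L : Submodule K (Fin 4 → K))
    (w : Fin 4 → K) : Finset (Fin 4 → K) :=
  Finset.univ.filter fun x => x ∈ L ∧ MvPolynomial.aeval (w + x) F = 0

theorem mem_fiberZeros {F : MvPolynomial (Fin 4) K} {L : Submodule K (Fin 4 → K)}
    {w x : Fin 4 → K} :
    x ∈ fiberZeros F L w ↔ x ∈ L ∧ MvPolynomial.aeval (w + x) F = 0 := by
  rw [fiberZeros, Finset.mem_filter, and_iff_right (Finset.mem_univ x)]

theorem card_filter_mem (L : Submodule K (Fin 4 → K)) :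
    (Finset.univ.filter fun x => x ∈ L).card = Fintype.card K ^ Module.finrank K L := by
  have h := Module.card_eq_pow_finrank (K := K) (V := L)
  rw [← h, Fintype.card_subtype]

/-- If `w + L` contains sufficiently many zeros of `F`, then `F` vanishes on some line through
each of them. -/
theorem exists_linePoly_eq_zero {F : MvPolynomial (Fin 4) K} {d : ℕ} (hF : F.IsHomogeneous d)
    (hd : 2 ≤ d) (hdq : d ≤ Fintype.card K + 1) {L : Submodule K (Fin 4 → K)}
    (hL : Module.finrank K L = 2) (hFL : VanishesOn F L) {w x : Fin 4 → K}
    (hx : x ∈ fiberZeros F L w)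
    (hcard : (d - 1) * Fintype.card K ≤ (fiberZeros F L w).card) :
    ∃ u ∈ L, u ≠ 0 ∧ linePoly F (w + x) u = 0 := by
  by_contra! hne
  obtain ⟨hxL, hx0⟩ := mem_fiberZeros.mp hx
  set A : Finset (Fin 4 → K) := Finset.univ.filter fun u => u ∈ L ∧ u ≠ 0 with hA
  set B : Finset K := Finset.univ.filter fun t => t ≠ 0 with hB
  have hAcard : A.card + 1 = Fintype.card K ^ 2 := by
    rw [← hL, ← card_filter_mem L]
    have : A = (Finset.univ.filter fun x => x ∈ L).erase 0 := by
      ext u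
      simp [hA, and_comm]
    rw [this]
    exact Finset.card_erase_add_one (by simp)
  have hBcard : B.card + 1 = Fintype.card K := by
    have : B = Finset.univ.erase 0 := by
      ext u
      simp [hB]
    rw [this]
    exact Finset.card_erase_add_one (by simp)
  let r : (Fin 4 → K) → K → Prop := fun u t => (linePoly F (w + x) u).eval t = 0
  have hdouble := Finset.sum_card_bipartiteAbove_eq_sum_card_bipartiteBelow (s := A) (t := B) r
  -- For fixed t ≠ 0, the map u ↦ x + tu is a bijection from the valid directions to the zeros other
  -- than x.
  have hbelow : ∀ t ∈ B, (Finset.bipartiteBelow r A t).card = (fiberZeros F L w).card - 1 := by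
    intro t ht
    have ht0 : t ≠ 0 := by simpa [hB] using ht
    rw [← Finset.card_erase_of_mem hx]
    refine Finset.card_nbij' (fun u => x + t • u) (fun y => t⁻¹ • (y - x)) ?_ ?_ ?_ ?_
    · intro u hu
      simp only [Finset.coe_bipartiteBelow, Set.mem_ofPred_eq, hA, Finset.mem_filter,
        Finset.mem_univ, true_and, r, eval_linePoly] at hu
      obtain ⟨⟨huL, hu0⟩, hu⟩ := hu
      simp only [Finset.coe_erase, Set.mem_sdiff, Finset.mem_coe, mem_fiberZeros,
        Set.mem_singleton_iff]
      refine ⟨⟨L.add_mem hxL (L.smul_mem _ huL), by rwa [← add_assoc]⟩, ?_⟩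
      simp [ht0, hu0]
    · intro y hy
      simp only [Finset.coe_erase, Set.mem_sdiff, Finset.mem_coe, mem_fiberZeros,
        Set.mem_singleton_iff] at hy
      obtain ⟨⟨hyL, hy⟩, hyx⟩ := hy
      simp only [Finset.coe_bipartiteBelow, Set.mem_ofPred_eq, hA, Finset.mem_filter,
        Finset.mem_univ, true_and, r, eval_linePoly]
      refine ⟨⟨L.smul_mem _ (L.sub_mem hyL hxL), ?_⟩, ?_⟩
      · simp [ht0, sub_eq_zero, hyx]
      · rw [smul_smul, mul_inv_cancel₀ ht0, one_smul]
        rw [add_assoc, add_sub_cancel]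
        exact hy
    · intro u _
      simp [smul_smul, inv_mul_cancel₀ ht0]
    · intro y _
      simp [smul_smul, mul_inv_cancel₀ ht0]
  rw [Finset.sum_congr rfl hbelow, Finset.sum_const, smul_eq_mul] at hdouble
  have hprop : ∀ u ∈ A, u ∈ L ∧ linePoly F (w + x) u ≠ 0 ∧
      (linePoly F (w + x) u).degree < d ∧ (linePoly F (w + x) u).coeff 0 = 0 := by
    intro u hu
    obtain ⟨huL, hu0⟩ : u ∈ L ∧ u ≠ 0 := by simpa [hA] using hu
    exact ⟨huL, hne u huL hu0, degree_linePoly_lt hF _ _ (hFL.aeval_eq_zero huL),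
      by rw [coeff_zero_linePoly, hx0]⟩
  have hroots : ∀ u, ∀ t ∈ Finset.bipartiteAbove r B u,
      t ≠ 0 ∧ (linePoly F (w + x) u).eval t = 0 := by
    intro u t ht
    simpa [Finset.bipartiteAbove, hB, r] using ht
  -- A tangent direction at w + x: there 0 is a double root. This makes the sum below strict, which
  -- is needed in the extreme case d = q + 1.
  obtain ⟨u₀, hu₀L, hu₀, hu₀g⟩ := exists_mem_ker_of_finrank hL.ge (gradFun F (w + x))
  have hu₀A : u₀ ∈ A := by simp [hA, hu₀L, hu₀]
  have hlt : ∑ u ∈ A, ((Finset.bipartiteAbove r B u).card + 2) < ∑ u ∈ A, d := by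
    refine Finset.sum_lt_sum (fun u hu => ?_) ⟨u₀, hu₀A, ?_⟩
    · obtain ⟨_, h1, h2, h3⟩ := hprop u hu
      have := card_add_lt_of_roots h1 h2 (e := 1)
        (by rw [pow_one]; exact Polynomial.X_dvd_iff.mpr h3) _ (hroots u)
      omega
    · obtain ⟨_, h1, h2, h3⟩ := hprop u₀ hu₀A
      have := card_add_lt_of_roots h1 h2 (e := 2)
        (Polynomial.X_pow_dvd_iff.mpr fun n hn => by
          interval_cases n
          · exact h3
          · exact hu₀g) _ (hroots u₀)
      omega
  rw [Finset.sum_add_distrib, hdouble, Finset.sum_const, Finset.sum_const, smul_eq_mul,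
    smul_eq_mul] at hlt
  have hpos : 1 ≤ (fiberZeros F L w).card := Finset.card_pos.mpr ⟨x, hx⟩
  obtain ⟨m, hm⟩ := Nat.exists_eq_add_of_le hpos
  obtain ⟨e, rfl⟩ := Nat.exists_eq_add_of_le hd
  obtain ⟨a, ha⟩ : ∃ a, A.card = a := ⟨_, rfl⟩
  obtain ⟨b, hb⟩ : ∃ b, B.card = b := ⟨_, rfl⟩
  rw [hm] at hcard
  rw [hm, ha, hb] at hlt
  rw [ha] at hAcard
  rw [hb] at hBcard
  rw [← hBcard] at hAcard hcard hdq
  -- Here b = q - 1, e = d - 2, a = q² - 1, and m is the number of zeros other than x. The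
  -- contradiction comes down to e ≤ b, that is, d ≤ q + 1.
  have ha2 : a = b * b + 2 * b := by nlinarith
  have he : e ≤ b := by omega
  have h1 : (2 + e - 1) = e + 1 := by omega
  have h2 : 1 + m - 1 = m := by omega
  rw [h1] at hcard
  rw [h2, ha2] at hlt
  have h3 : e * b ≤ b * b := Nat.mul_le_mul_right _ he
  have h4 : b * (e * b + e + b) ≤ b * m := Nat.mul_le_mul_left _ (by nlinarith)
  nlinarith

/-- The parameters in `L` of the points of `M` in the affine plane `w + L`. -/
noncomputable def fiberLine (M L : Submodule K (Fin 4 → K)) (w : Fin 4 → K) :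
    Finset (Fin 4 → K) :=
  Finset.univ.filter fun x => x ∈ L ∧ w + x ∈ M

theorem mem_fiberLine {M L : Submodule K (Fin 4 → K)} {w x : Fin 4 → K} :
    x ∈ fiberLine M L w ↔ x ∈ L ∧ w + x ∈ M := by
  simp [fiberLine]

/-- If nonempty, this set is a coset of M ∩ L, which has dimension 1. -/
theorem card_fiberLine_le {M L W : Submodule K (Fin 4 → K)} (hM : M ≤ W) (hL : L ≤ W)
    (hW : Module.finrank K W = 3) (hM2 : Module.finrank K M = 2) (hL2 : Module.finrank K L = 2)
    (hne : M ≠ L) (w : Fin 4 → K) : (fiberLine M L w).card ≤ Fintype.card K := by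
  rcases (fiberLine M L w).eq_empty_or_nonempty with h | ⟨x₁, hx₁⟩
  · simp [h]
  obtain ⟨hx₁L, hx₁M⟩ := mem_fiberLine.mp hx₁
  have h1 := card_filter_mem (M ⊓ L)
  rw [finrank_inf_eq_one hM hL hW hM2 hL2 hne, pow_one] at h1
  rw [← h1]
  refine Finset.card_le_card_of_injOn (fun x => x - x₁) ?_ ?_
  · intro x hx
    obtain ⟨hxL, hxM⟩ := mem_fiberLine.mp hx
    simp only [Finset.coe_filter, Finset.mem_univ, true_and, Set.mem_ofPred_eq, Submodule.mem_inf]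
    refine ⟨?_, L.sub_mem hxL hx₁L⟩
    have := M.sub_mem hxM hx₁M
    rwa [add_sub_add_left_eq_sub] at this
  · intro x _ y _ h
    exact sub_left_injective h

noncomputable instance : Fintype (Submodule K (Fin 4 → K)) := Fintype.ofFinite _

/-- The lines in `W` on which `F` vanishes. -/
noncomputable def linesIn (F : MvPolynomial (Fin 4) K) (W : Submodule K (Fin 4 → K)) :
    Finset (Submodule K (Fin 4 → K)) :=
  Finset.univ.filter fun M => M ≤ W ∧ Module.finrank K M = 2 ∧ VanishesOn F M

theorem mem_linesIn {F : MvPolynomial (Fin 4) K} {M W : Submodule K (Fin 4 → K)} :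
    M ∈ linesIn F W ↔ M ≤ W ∧ Module.finrank K M = 2 ∧ VanishesOn F M := by
  simp [linesIn]

theorem span_pair_mem_linesIn {F : MvPolynomial (Fin 4) K} {d : ℕ} (hF : F.IsHomogeneous d)
    {L W : Submodule K (Fin 4 → K)} (hLW : L ≤ W) {x u : Fin 4 → K} (hxW : x ∈ W) (hx : x ∉ L)
    (huL : u ∈ L) (hu : u ≠ 0) (h0 : linePoly F x u = 0) :
    Submodule.span K {x, u} ∈ linesIn F W := by
  refine mem_linesIn.mpr ⟨?_, finrank_span_pair_of_notMem huL hu hx,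
    (vanishesOn_span_pair_iff hF x u).mpr h0⟩
  rw [Submodule.span_le]
  rintro y (rfl | rfl)
  · exact hxW
  · exact hLW huL

/-- The line through w + x with direction u in L lies in W, and it is not L because w + x is off L.
-/
theorem fiberZeros_subset {F : MvPolynomial (Fin 4) K} {d : ℕ} (hF : F.IsHomogeneous d)
    (hd : 2 ≤ d) (hdq : d ≤ Fintype.card K + 1) {L W : Submodule K (Fin 4 → K)} (hLW : L ≤ W)
    (hL : Module.finrank K L = 2) (hFL : VanishesOn F L) {w : Fin 4 → K} (hwW : w ∈ W)
    (hw : w ∉ L) (hcard : (d - 1) * Fintype.card K ≤ (fiberZeros F L w).card) :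
    fiberZeros F L w ⊆ ((linesIn F W).erase L).biUnion fun M => fiberLine M L w := by
  intro x hx
  have hxL := (mem_fiberZeros.mp hx).1
  obtain ⟨u, huL, hu, h0⟩ := exists_linePoly_eq_zero hF hd hdq hL hFL hx hcard
  have hwx : w + x ∉ L := fun h => hw ((L.add_mem_iff_left hxL).mp h)
  have hmem : w + x ∈ Submodule.span K {w + x, u} := Submodule.subset_span (by simp)
  refine Finset.mem_biUnion.mpr ⟨Submodule.span K {w + x, u}, Finset.mem_erase.mpr ⟨?_, ?_⟩,
    mem_fiberLine.mpr ⟨hxL, hmem⟩⟩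
  · intro h
    rw [h] at hmem
    exact hwx hmem
  · exact span_pair_mem_linesIn hF hLW (W.add_mem hwW (hLW hxL)) hwx huL hu h0

theorem card_linesIn_erase_le {F : MvPolynomial (Fin 4) K} {d : ℕ} (hF : F.IsHomogeneous d)
    (hplane : HasNoPlaneComponent F) {L W : Submodule K (Fin 4 → K)} (hLW : L ≤ W)
    (hW : Module.finrank K W = 3) (hL : Module.finrank K L = 2) (hFL : VanishesOn F L) :
    ((linesIn F W).erase L).card + 1 = (linesIn F W).card ∧ (linesIn F W).card ≤ d :=
  ⟨Finset.card_erase_add_one (mem_linesIn.mpr ⟨hLW, hL, hFL⟩),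
    (card_lines_aux hF hplane hW _ fun _ hM => mem_linesIn.mp hM).1⟩

theorem card_fiberZeros_le {F : MvPolynomial (Fin 4) K} {d : ℕ} (hF : F.IsHomogeneous d)
    (hplane : HasNoPlaneComponent F) (hd : 2 ≤ d) (hdq : d ≤ Fintype.card K + 1)
    {L : Submodule K (Fin 4 → K)} (hL : Module.finrank K L = 2)
    (hFL : VanishesOn F L) {w : Fin 4 → K} (hw : w ∉ L) :
    (fiberZeros F L w).card ≤ (d - 1) * Fintype.card K := by
  by_contra! hlt
  have hLW : L ≤ L ⊔ K ∙ w := le_sup_left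
  have hwW : w ∈ L ⊔ K ∙ w := le_sup_right (a := L) (Submodule.mem_span_singleton_self w)
  have hW : Module.finrank K (L ⊔ K ∙ w : Submodule K (Fin 4 → K)) = 3 := by
    rw [finrank_sup_span_singleton hw, hL]
  have h1 := Finset.card_le_card (fiberZeros_subset hF hd hdq hLW hL hFL hwW hw hlt.le)
  have h2 := Finset.card_biUnion_le_card_mul ((linesIn F (L ⊔ K ∙ w)).erase L)
    (fun M => fiberLine M L w) (Fintype.card K) (fun M hM => by
      obtain ⟨hne, hM⟩ := Finset.mem_erase.mp hM
      obtain ⟨hMW, hM2, -⟩ := mem_linesIn.mp hM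
      exact card_fiberLine_le hMW hLW hW hM2 hL hne w)
  obtain ⟨h3, h4⟩ := card_linesIn_erase_le hF hplane hLW hW hL hFL
  have h5 : ((linesIn F (L ⊔ K ∙ w)).erase L).card * Fintype.card K ≤
      (d - 1) * Fintype.card K := Nat.mul_le_mul_right _ (by omega)
  omega

/-- If `w + L` contains the maximal number of zeros of `F`, then `F` vanishes on `d` concurrent
lines of the plane `W` spanned by `w` and `L`. -/
theorem exists_vertex {F : MvPolynomial (Fin 4) K} {d : ℕ} (hF : F.IsHomogeneous d)
    (hplane : HasNoPlaneComponent F) (hd : 2 ≤ d) (hdq : d ≤ Fintype.card K + 1)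
    {L W : Submodule K (Fin 4 → K)} (hLW : L ≤ W) (hW : Module.finrank K W = 3)
    (hL : Module.finrank K L = 2) (hFL : VanishesOn F L) {w : Fin 4 → K} (hwW : w ∈ W)
    (hw : w ∉ L) (hcard : (fiberZeros F L w).card = (d - 1) * Fintype.card K) :
    (linesIn F W).card = d ∧ ∃ v ∈ L, v ≠ 0 ∧ ∀ M ∈ linesIn F W, v ∈ M := by
  have hsub := fiberZeros_subset hF hd hdq hLW hL hFL hwW hw hcard.ge
  obtain ⟨h3, h4⟩ := card_linesIn_erase_le hF hplane hLW hW hL hFL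
  have hline : ∀ M ∈ (linesIn F W).erase L, (fiberLine M L w).card ≤ Fintype.card K := by
    intro M hM
    obtain ⟨hne, hM⟩ := Finset.mem_erase.mp hM
    obtain ⟨hMW, hM2, -⟩ := mem_linesIn.mp hM
    exact card_fiberLine_le hMW hLW hW hM2 hL hne w
  have hq : 0 < Fintype.card K := Fintype.card_pos
  have h5 : d - 1 ≤ ((linesIn F W).erase L).card := by
    have h1 := Finset.card_le_card hsub
    have h2 := Finset.card_biUnion_le_card_mul _ _ _ hline
    rw [hcard] at h1
    exact Nat.le_of_mul_le_mul_right (h1.trans h2) hq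
  refine ⟨by omega, ?_⟩
  obtain ⟨M₂, hM₂⟩ : ((linesIn F W).erase L).Nonempty := Finset.card_pos.mp (by omega)
  obtain ⟨hM₂L, hM₂'⟩ := Finset.mem_erase.mp hM₂
  obtain ⟨hM₂W, hM₂2, -⟩ := mem_linesIn.mp hM₂'
  have hone := finrank_inf_eq_one hM₂W hLW hW hM₂2 hL hM₂L
  obtain ⟨v, hv, hv0⟩ := Submodule.exists_mem_ne_zero_of_ne_bot
    (show M₂ ⊓ L ≠ ⊥ by intro h; rw [h, finrank_bot] at hone; omega)
  obtain ⟨hvM₂, hvL⟩ := Submodule.mem_inf.mp hv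
  refine ⟨v, hvL, hv0, fun M hM => ?_⟩
  by_contra hvM
  obtain ⟨hMW, hM2, -⟩ := mem_linesIn.mp hM
  have hML : M ≠ L := fun h => hvM (h ▸ hvL)
  have hMM₂ : M₂ ≠ M := fun h => hvM (h ▸ hvM₂)
  have hone' := finrank_inf_eq_one hM₂W hMW hW hM₂2 hM2 hMM₂
  obtain ⟨z, hz, hz0⟩ := Submodule.exists_mem_ne_zero_of_ne_bot
    (show M₂ ⊓ M ≠ ⊥ by intro h; rw [h, finrank_bot] at hone'; omega)
  obtain ⟨hzM₂, hzM⟩ := Submodule.mem_inf.mp hz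
  -- Otherwise z would span M₂ ∩ L, and M would contain v.
  have hzL : z ∉ L := by
    intro hzL
    obtain ⟨c, rfl⟩ := exists_smul_eq_of_finrank_one hone (Submodule.mem_inf.mpr ⟨hzM₂, hzL⟩) hz0 hv
    exact hvM (M.smul_mem c hzM)
  obtain ⟨m, hm, c, rfl⟩ := exists_add_smul_eq hLW (by rw [hW, hL]) hwW hw (hM₂W hzM₂)
  have hc : c ≠ 0 := by
    rintro rfl
    rw [zero_smul, add_zero] at hzL
    exact hzL hm
  have hresc : ∀ N : Submodule K (Fin 4 → K), m + c • w ∈ N → w + c⁻¹ • m ∈ N := by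
    intro N hN
    have := N.smul_mem c⁻¹ hN
    rwa [smul_add, smul_smul, inv_mul_cancel₀ hc, one_smul, add_comm] at this
  -- M and M₂ meet in an affine point, the rescaling of z, which need only be counted on M. This
  -- leaves at most (d-2)q + (q-1) zeros, one too few.
  have hsub' : fiberZeros F L w ⊆
      (((linesIn F W).erase L).erase M₂).biUnion (fun M => fiberLine M L w) ∪
        (fiberLine M₂ L w).erase (c⁻¹ • m) := by
    intro x hx
    obtain ⟨N, hN, hxN⟩ := Finset.mem_biUnion.mp (hsub hx)
    rw [Finset.mem_union, Finset.mem_biUnion]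
    by_cases hNM : N = M₂
    · by_cases hxm : x = c⁻¹ • m
      · refine Or.inl ⟨M, Finset.mem_erase.mpr ⟨hMM₂.symm, Finset.mem_erase.mpr ⟨hML, hM⟩⟩, ?_⟩
        rw [hxm]
        exact mem_fiberLine.mpr ⟨L.smul_mem _ hm, hresc M hzM⟩
      · exact Or.inr (Finset.mem_erase.mpr ⟨hxm, hNM ▸ hxN⟩)
    · exact Or.inl ⟨N, Finset.mem_erase.mpr ⟨hNM, hN⟩, hxN⟩
  have k1 := (Finset.card_le_card hsub').trans (Finset.card_union_le _ _)
  have k2 := Finset.card_biUnion_le_card_mul (((linesIn F W).erase L).erase M₂)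
    (fun M => fiberLine M L w) (Fintype.card K) fun N hN => hline N (Finset.mem_of_mem_erase hN)
  have k3 : ((fiberLine M₂ L w).erase (c⁻¹ • m)).card + 1 ≤ Fintype.card K := by
    rw [Finset.card_erase_add_one (mem_fiberLine.mpr ⟨L.smul_mem _ hm, hresc M₂ hzM₂⟩)]
    exact hline M₂ hM₂
  have k4 := Finset.card_erase_add_one hM₂
  have k5 : ((linesIn F W).erase L).card = d - 1 := by omega
  rw [hcard, ← k5, ← k4, add_mul, one_mul] at k1
  omega

/-- A point of `L` at which `W` is the tangent plane lies on a further line in `W`. -/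
theorem exists_linePoly_eq_zero_of_gradFun {F : MvPolynomial (Fin 4) K} {d : ℕ}
    (hF : F.IsHomogeneous d) (hd : 2 ≤ d) {L : Submodule K (Fin 4 → K)}
    (hL : Module.finrank K L = 2) (hFL : VanishesOn F L) {w u : Fin 4 → K}
    (hcard : (fiberZeros F L w).card = (d - 1) * Fintype.card K)
    (hu : u ∈ L) (hg : ∀ x ∈ L, gradFun F u (w + x) = 0) :
    ∃ x ∈ L, linePoly F (w + x) u = 0 := by
  by_contra! hne
  set A : Finset (Fin 4 → K) := Finset.univ.filter fun x => x ∈ L with hA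
  have hAcard : A.card = Fintype.card K ^ 2 := by rw [hA, card_filter_mem, hL]
  let r : (Fin 4 → K) → K → Prop := fun x t => (linePoly F (w + x) u).eval t = 0
  have hdouble := Finset.sum_card_bipartiteAbove_eq_sum_card_bipartiteBelow (s := A)
    (t := (Finset.univ : Finset K)) r
  have hbelow : ∀ t ∈ (Finset.univ : Finset K),
      (Finset.bipartiteBelow r A t).card = (fiberZeros F L w).card := by
    intro t _
    refine Finset.card_nbij' (fun x => x + t • u) (fun y => y - t • u) ?_ ?_ ?_ ?_
    · intro x hx
      simp only [Finset.coe_bipartiteBelow, Set.mem_ofPred_eq, hA, Finset.mem_filter,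
        Finset.mem_univ, true_and, r, eval_linePoly] at hx
      simp only [Finset.mem_coe, mem_fiberZeros]
      exact ⟨L.add_mem hx.1 (L.smul_mem _ hu), by rw [← add_assoc]; exact hx.2⟩
    · intro y hy
      simp only [Finset.mem_coe, mem_fiberZeros] at hy
      simp only [Finset.coe_bipartiteBelow, Set.mem_ofPred_eq, hA, Finset.mem_filter,
        Finset.mem_univ, true_and, r, eval_linePoly]
      exact ⟨L.sub_mem hy.1 (L.smul_mem _ hu), by rw [add_assoc, sub_add_cancel]; exact hy.2⟩
    · intro x _
      simp
    · intro y _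
      simp
  rw [Finset.sum_congr rfl hbelow, Finset.sum_const, smul_eq_mul, hcard] at hdouble
  -- Tangency at u leaves degree at most d - 2 on each line through u, hence at most q²(d-2)
  -- incidences against the q·(d-1)q found above.
  have hle : ∑ x ∈ A, (Finset.bipartiteAbove r Finset.univ x).card ≤ ∑ x ∈ A, (d - 2) := by
    refine Finset.sum_le_sum fun x hx => ?_
    have hxL : x ∈ L := by simpa [hA] using hx
    have := card_lt_of_roots (hne x hxL)
      (degree_linePoly_lt_pred hd hF _ _ (hFL.aeval_eq_zero hu) (hg x hxL))
      (Finset.bipartiteAbove r Finset.univ x) fun t ht => by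
        simpa [Finset.bipartiteAbove, r] using ht
    omega
  rw [hdouble, Finset.sum_const, smul_eq_mul, hAcard, Finset.card_univ] at hle
  obtain ⟨e, rfl⟩ := Nat.exists_eq_add_of_le hd
  have h1 : 2 + e - 1 = e + 1 := by omega
  have h2 : 2 + e - 2 = e := by omega
  rw [h1, h2] at hle
  have hq : 0 < Fintype.card K := Fintype.card_pos
  nlinarith [Nat.mul_pos hq hq]

end Counting

/-! ### From subspaces to subsets of projective space -/

section Loci

variable {K : Type*} [Field K]

theorem mk_mem_surfaceOf {F : MvPolynomial (Fin 4) K} {d : ℕ} (hF : F.IsHomogeneous d)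
    (y : Fin 4 → AlgebraicClosure K) (hy : y ≠ 0) :
    Projectivization.mk (AlgebraicClosure K) y hy ∈ surfaceOf F ↔ MvPolynomial.aeval y F = 0 := by
  obtain ⟨a, ha⟩ := Projectivization.exists_smul_eq_mk_rep (AlgebraicClosure K) y hy
  change MvPolynomial.aeval (Projectivization.mk (AlgebraicClosure K) y hy).rep F = 0 ↔ _
  rw [← ha, Units.smul_def, aeval_smul_of_isHomogeneous hF, mul_eq_zero,
    or_iff_right (pow_ne_zero _ a.ne_zero)]

theorem mk_mem_linearLocus {W : Submodule K (Fin 4 → K)} (y : Fin 4 → AlgebraicClosure K)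
    (hy : y ≠ 0) :
    Projectivization.mk (AlgebraicClosure K) y hy ∈ linearLocus W ↔ y ∈ ratSpan W := by
  change (Projectivization.mk (AlgebraicClosure K) y hy).submodule ≤ ratSpan W ↔ _
  rw [Projectivization.submodule_mk, Submodule.span_singleton_le_iff_mem]

theorem mem_linearLocus {W : Submodule K (Fin 4 → K)} {P : PThree K} :
    P ∈ linearLocus W ↔ P.rep ∈ ratSpan W := by
  change P.submodule ≤ ratSpan W ↔ _
  rw [Projectivization.submodule_eq, Submodule.span_singleton_le_iff_mem]

theorem ratVec_ne_zero {x : Fin 4 → K} (hx : x ≠ 0) : ratVec K x ≠ 0 :=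
  (map_ne_zero_iff (ratVec K) (ratVec_injective K)).mpr hx

theorem linearLocus_subset_iff {M W : Submodule K (Fin 4 → K)} :
    linearLocus M ⊆ linearLocus W ↔ M ≤ W := by
  refine ⟨fun h x hx => ?_, fun h P hP => mem_linearLocus.mpr
    (ratSpan_mono h (mem_linearLocus.mp hP))⟩
  by_cases hx0 : x = 0
  · rw [hx0]
    exact W.zero_mem
  · have := h ((mk_mem_linearLocus _ (ratVec_ne_zero hx0)).mpr (ratVec_mem_of_mem hx))
    exact ratVec_mem_ratSpan.mp ((mk_mem_linearLocus _ _).mp this)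

theorem linearLocus_injective :
    Function.Injective (linearLocus : Submodule K (Fin 4 → K) → Set (PThree K)) :=
  fun _ _ h => le_antisymm (linearLocus_subset_iff.mp h.subset)
    (linearLocus_subset_iff.mp h.symm.subset)

theorem linearLocus_subset_surfaceOf_iff {F : MvPolynomial (Fin 4) K} {d : ℕ}
    (hF : F.IsHomogeneous d) (hd : d ≠ 0) {M : Submodule K (Fin 4 → K)} :
    linearLocus M ⊆ surfaceOf F ↔ VanishesOn F M := by
  constructor
  · intro h y hy
    by_cases hy0 : y = 0
    · have := aeval_smul_of_isHomogeneous hF (0 : AlgebraicClosure K) y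
      rw [hy0]
      simpa [hd] using this
    · exact (mk_mem_surfaceOf hF y hy0).mp (h ((mk_mem_linearLocus y hy0).mpr hy))
  · intro h P hP
    exact h _ (mem_linearLocus.mp hP)

theorem ratPoint_mk (x : Fin 4 → K) (hx : x ≠ 0) :
    ratPoint K (Projectivization.mk K x hx) =
      Projectivization.mk (AlgebraicClosure K) (ratVec K x) (ratVec_ne_zero hx) := rfl

theorem ratPoint_mk_mem_linearLocus {W : Submodule K (Fin 4 → K)} {x : Fin 4 → K} (hx : x ≠ 0) :
    ratPoint K (Projectivization.mk K x hx) ∈ linearLocus W ↔ x ∈ W := by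
  rw [ratPoint_mk, mk_mem_linearLocus, ratVec_mem_ratSpan]

theorem ratPoint_injective : Function.Injective (ratPoint K) := by
  intro p p' h
  rw [← Projectivization.mk_rep p, ← Projectivization.mk_rep p'] at h ⊢
  have h1 : ratPoint K (Projectivization.mk K p.rep p.rep_nonzero) ∈
      linearLocus (K ∙ p'.rep) := by
    rw [h, ratPoint_mk_mem_linearLocus]
    exact Submodule.mem_span_singleton_self _
  rw [ratPoint_mk_mem_linearLocus] at h1
  exact (Projectivization.mk_eq_mk_iff' K _ _ _ _).mpr (Submodule.mem_span_singleton.mp h1)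

theorem numRatPoints_surfaceOf {F : MvPolynomial (Fin 4) K} {d : ℕ} (hF : F.IsHomogeneous d) :
    numRatPoints (surfaceOf F) =
      {p : Projectivization K (Fin 4 → K) | MvPolynomial.aeval p.rep F = 0}.ncard := by
  have h : ratPoints (surfaceOf F) =
      ratPoint K '' {p : Projectivization K (Fin 4 → K) | MvPolynomial.aeval p.rep F = 0} := by
    have key : ∀ p : Projectivization K (Fin 4 → K),
        ratPoint K p ∈ surfaceOf F ↔ MvPolynomial.aeval p.rep F = 0 := by
      intro p
      conv_lhs => rw [← Projectivization.mk_rep p, ratPoint_mk]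
      rw [mk_mem_surfaceOf hF, aeval_ratVec]
      exact map_eq_zero_iff _ (algebraMap K (AlgebraicClosure K)).injective
    ext P
    constructor
    · rintro ⟨hP, p, rfl⟩
      exact ⟨p, (key p).mp hP, rfl⟩
    · rintro ⟨p, hp, rfl⟩
      exact ⟨(key p).mpr hp, p, rfl⟩
  rw [numRatPoints, h, Set.ncard_image_of_injective _ ratPoint_injective]

end Loci

/-! ### The global count -/

section Total

open scoped Classical

variable {K : Type*} [Field K] [Fintype K]

theorem card_mk_eq (p : Projectivization K (Fin 4 → K)) :
    (Finset.univ.filter fun x : {x : Fin 4 → K // x ≠ 0} =>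
      Projectivization.mk K x.1 x.2 = p).card = Fintype.card K - 1 := by
  rw [← Fintype.card_units, ← Finset.card_univ]
  symm
  refine Finset.card_bij
    (fun c _ => ⟨(c : K) • p.rep, smul_ne_zero c.ne_zero p.rep_nonzero⟩) ?_ ?_ ?_
  · intro c _
    rw [Finset.mem_filter]
    refine ⟨Finset.mem_univ _, ?_⟩
    conv_rhs => rw [← Projectivization.mk_rep p]
    exact (Projectivization.mk_eq_mk_iff K _ _ _ _).mpr ⟨c, rfl⟩
  · intro c _ c' _ h
    have h2 : (c : K) • p.rep = (c' : K) • p.rep := congrArg Subtype.val h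
    exact Units.ext (smul_left_injective K p.rep_nonzero h2)
  · intro x hx
    have hx := (Finset.mem_filter.mp hx).2
    rw [← Projectivization.mk_rep p, Projectivization.mk_eq_mk_iff] at hx
    obtain ⟨c, hc⟩ := hx
    exact ⟨c, Finset.mem_univ _, Subtype.ext hc⟩

theorem card_zeros {F : MvPolynomial (Fin 4) K} {d : ℕ} (hF : F.IsHomogeneous d) (hd : d ≠ 0) :
    (Finset.univ.filter fun x : Fin 4 → K => MvPolynomial.aeval x F = 0).card =
      1 + numRatPoints (surfaceOf F) * (Fintype.card K - 1) := by
  have hfin : Finite (Projectivization K (Fin 4 → K)) := inferInstance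
  have := Fintype.ofFinite (Projectivization K (Fin 4 → K))
  have h0 : MvPolynomial.aeval (0 : Fin 4 → K) F = 0 := by
    have := aeval_smul_of_isHomogeneous hF (0 : K) (0 : Fin 4 → K)
    rw [zero_smul, zero_pow hd, zero_mul] at this
    exact this
  have hmem : (0 : Fin 4 → K) ∈
      Finset.univ.filter fun x : Fin 4 → K => MvPolynomial.aeval x F = 0 :=
    Finset.mem_filter.mpr ⟨Finset.mem_univ _, h0⟩
  rw [← Finset.card_erase_add_one hmem, add_comm]
  congr 1
  have hmk : ∀ x : {x : Fin 4 → K // x ≠ 0},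
      MvPolynomial.aeval (Projectivization.mk K x.1 x.2).rep F = 0 ↔
        MvPolynomial.aeval x.1 F = 0 := by
    intro x
    obtain ⟨a, ha⟩ := Projectivization.exists_smul_eq_mk_rep K x.1 x.2
    rw [← ha, Units.smul_def, aeval_smul_of_isHomogeneous hF, mul_eq_zero,
      or_iff_right (pow_ne_zero _ a.ne_zero)]
  have h1 : ((Finset.univ.filter fun x : Fin 4 → K => MvPolynomial.aeval x F = 0).erase 0).card =
      (Finset.univ.filter fun x : {x : Fin 4 → K // x ≠ 0} =>
        MvPolynomial.aeval x.1 F = 0).card := by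
    symm
    refine Finset.card_bij (fun x _ => x.1) ?_ ?_ ?_
    · intro x hx
      exact Finset.mem_erase.mpr ⟨x.2, Finset.mem_filter.mpr
        ⟨Finset.mem_univ _, (Finset.mem_filter.mp hx).2⟩⟩
    · intro x _ y _ h
      exact Subtype.ext h
    · intro x hx
      obtain ⟨hx0, hx⟩ := Finset.mem_erase.mp hx
      exact ⟨⟨x, hx0⟩, Finset.mem_filter.mpr
        ⟨Finset.mem_univ _, (Finset.mem_filter.mp hx).2⟩, rfl⟩
  set s : Finset (Projectivization K (Fin 4 → K)) :=
    Finset.univ.filter fun p => MvPolynomial.aeval p.rep F = 0 with hs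
  have h2 : numRatPoints (surfaceOf F) = s.card := by
    rw [numRatPoints_surfaceOf hF, ← Set.ncard_coe_finset]
    congr 1
    ext p
    rw [hs, Finset.mem_coe, Finset.mem_filter, and_iff_right (Finset.mem_univ p)]
    rfl
  rw [h1, h2, Finset.card_eq_sum_card_fiberwise
    (f := fun x : {x : Fin 4 → K // x ≠ 0} => Projectivization.mk K x.1 x.2) (t := s)]
  · rw [← smul_eq_mul, ← Finset.sum_const]
    refine Finset.sum_congr rfl fun p hp => ?_
    rw [← card_mk_eq p, Finset.filter_filter]
    congr 1
    refine Finset.filter_congr fun x _ => ⟨fun h => h.2, fun h => ⟨?_, h⟩⟩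
    rw [← hmk, h]
    exact (Finset.mem_filter.mp hp).2
  · intro x hx
    have hx := (Finset.mem_filter.mp hx).2
    exact Finset.mem_filter.mpr ⟨Finset.mem_univ _, (hmk x).mpr hx⟩

/-- If `S` has the maximal number of points, then so have all plane sections through a line
in `S`. -/
theorem card_fiberZeros_eq {F : MvPolynomial (Fin 4) K} {d : ℕ} (hF : F.IsHomogeneous d)
    (hplane : HasNoPlaneComponent F) (hd : 2 ≤ d) (hdq : d ≤ Fintype.card K + 1)
    (hN : numRatPoints (surfaceOf F) =
      (d - 1) * Fintype.card K ^ 2 + d * Fintype.card K + 1)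
    {L : Submodule K (Fin 4 → K)} (hL : Module.finrank K L = 2) (hFL : VanishesOn F L)
    {w : Fin 4 → K} (hw : w ∉ L) :
    (fiberZeros F L w).card = (d - 1) * Fintype.card K := by
  set A : Finset (Fin 4 → K) := Finset.univ.filter fun x => x ∈ L with hA
  have hAcard : A.card = Fintype.card K ^ 2 := by rw [hA, card_filter_mem, hL]
  set Z : Finset (Fin 4 → K) := Finset.univ.filter fun x => MvPolynomial.aeval x F = 0 with hZ
  have hZcard := card_zeros hF (by omega : d ≠ 0)
  rw [← hZ, hN] at hZcard
  -- Pairs (w, x) with w arbitrary and x in L: each zero of F equals w + x for exactly q² of them.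
  let r : (Fin 4 → K) → (Fin 4 → K) → Prop := fun w x => MvPolynomial.aeval (w + x) F = 0
  have hdouble := Finset.sum_card_bipartiteAbove_eq_sum_card_bipartiteBelow
    (s := (Finset.univ : Finset (Fin 4 → K))) (t := A) r
  have habove : ∀ w, Finset.bipartiteAbove r A w = fiberZeros F L w := by
    intro w
    rw [Finset.bipartiteAbove, hA, Finset.filter_filter]
    rfl
  have hbelow : ∀ x ∈ A, (Finset.bipartiteBelow r Finset.univ x).card = Z.card := by
    intro x _
    refine Finset.card_nbij' (fun y => y + x) (fun y => y - x) ?_ ?_ ?_ ?_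
    · intro y hy
      exact Finset.mem_filter.mpr ⟨Finset.mem_univ _, (Finset.mem_filter.mp hy).2⟩
    · intro y hy
      refine Finset.mem_filter.mpr ⟨Finset.mem_univ _, ?_⟩
      change MvPolynomial.aeval (y - x + x) F = 0
      rw [sub_add_cancel]
      exact (Finset.mem_filter.mp hy).2
    · intro y _
      simp
    · intro y _
      simp
  rw [Finset.sum_congr rfl hbelow, Finset.sum_const, smul_eq_mul, hAcard] at hdouble
  simp_rw [habove] at hdouble
  set g : (Fin 4 → K) → ℕ := fun w =>
    if w ∈ L then Fintype.card K ^ 2 else (d - 1) * Fintype.card K with hg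
  have hle : ∀ w ∈ (Finset.univ : Finset (Fin 4 → K)), (fiberZeros F L w).card ≤ g w := by
    intro w _
    by_cases hwL : w ∈ L
    · simp only [hg, if_pos hwL]
      rw [← hAcard]
      refine Finset.card_le_card fun x hx => ?_
      exact Finset.mem_filter.mpr ⟨Finset.mem_univ _, (mem_fiberZeros.mp hx).1⟩
    · simp only [hg, if_neg hwL]
      exact card_fiberZeros_le hF hplane hd hdq hL hFL hwL
  -- The termwise bounds add up to exactly the prescribed count, so each of them is an equality.
  have hgsum : ∑ w, g w = Fintype.card K ^ 2 * Z.card := by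
    have hcompl : (Finset.univ.filter fun w : Fin 4 → K => w ∉ L).card + Fintype.card K ^ 2 =
        Fintype.card K ^ 4 := by
      have h1 := Finset.card_filter_add_card_filter_not (s := (Finset.univ : Finset (Fin 4 → K)))
        (fun w => w ∈ L)
      rw [← hA, hAcard, Finset.card_univ, Fintype.card_fun, Fintype.card_fin] at h1
      rw [add_comm]
      exact h1
    rw [hg, Finset.sum_ite, Finset.sum_const, Finset.sum_const, ← hA, hAcard, smul_eq_mul,
      smul_eq_mul, hZcard]
    obtain ⟨b, hb⟩ := Nat.exists_eq_add_of_lt (Fintype.card_pos (α := K))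
    obtain ⟨c, hc⟩ : ∃ c, (Finset.univ.filter fun w : Fin 4 → K => w ∉ L).card = c := ⟨_, rfl⟩
    obtain ⟨e, rfl⟩ := Nat.exists_eq_add_of_le hd
    rw [hc] at hcompl ⊢
    rw [hb] at hcompl ⊢
    have h1 : 2 + e - 1 = e + 1 := by omega
    have h2 : 0 + b + 1 - 1 = b := by omega
    rw [h1, h2]
    zify at hcompl ⊢
    have h3 : (c : ℤ) = (0 + b + 1) ^ 4 - (0 + b + 1) ^ 2 := by linarith
    rw [h3]
    ring
  have heq := (Finset.sum_eq_sum_iff_of_le hle).mp (by rw [hdouble, hgsum])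
  have := heq w (Finset.mem_univ w)
  simpa only [hg, if_neg hw] using this

end Total

/-! ### Intersections of lines and tangent planes -/

theorem VanishesOn.gradFun_eq_zero {K : Type*} [Field K] {F : MvPolynomial (Fin 4) K}
    {d : ℕ} (hF : F.IsHomogeneous d) {M : Submodule K (Fin 4 → K)} (hFM : VanishesOn F M) {u x : Fin 4 → K} (hu : u ∈ M)
    (hx : x ∈ M) : gradFun F u x = 0 := by
  have h : VanishesOn F (Submodule.span K {u, x}) := by
    refine hFM.mono (Submodule.span_le.mpr ?_)
    rintro y (rfl | rfl)
    · exact hu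
    · exact hx
  rw [gradFun_apply, (vanishesOn_span_pair_iff hF u x).mp h, Polynomial.coeff_zero]

theorem eq_ratPoint_of_mem_inter {K : Type*} [Field K] {L M : Submodule K (Fin 4 → K)}
    (hL : Module.finrank K L = 2) (hM : Module.finrank K M = 2)
    (hne : M ≠ L) {v : Fin 4 → K} (hvL : v ∈ L) (hvM : v ∈ M) (hv0 : v ≠ 0) {P : PThree K}
    (hPL : P ∈ linearLocus L) (hPM : P ∈ linearLocus M) :
    P = ratPoint K (Projectivization.mk K v hv0) := by
  have : ∃ a ∈ L, a ∉ M := by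
    by_contra! hle
    exact hne (Submodule.eq_of_le_of_finrank_eq hle (by rw [hM, hL])).symm
  obtain ⟨a, haL, haM⟩ := this
  obtain ⟨φ, hφa, hφM⟩ := exists_functional_of_notMem haM
  have hav : a ∉ K ∙ v := fun h => haM ((Submodule.span_singleton_le_iff_mem v M).mpr hvM h)
  have hLs : (K ∙ v) ⊔ K ∙ a = L :=
    sup_span_singleton_eq ((Submodule.span_singleton_le_iff_mem v L).mpr hvL)
      (by rw [hL, finrank_span_singleton hv0]) haL hav
  rw [mem_linearLocus] at hPL hPM
  rw [← hLs, ratSpan_sup, ratSpan_singleton, ratSpan_singleton] at hPL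
  obtain ⟨m, hm, n, hn, hmn⟩ := Submodule.mem_sup.mp hPL
  obtain ⟨b, rfl⟩ := Submodule.mem_span_singleton.mp hm
  obtain ⟨c, rfl⟩ := Submodule.mem_span_singleton.mp hn
  have h1 := extFun_eq_zero hφM hPM
  rw [← hmn, map_add, map_smul, map_smul, extFun_ratVec, extFun_ratVec, hφM v hvM, map_zero,
    smul_zero, zero_add, smul_eq_mul, mul_eq_zero] at h1
  have h2 : algebraMap K (AlgebraicClosure K) (φ a) ≠ 0 := by simpa using hφa
  rw [h1.resolve_right h2, zero_smul, add_zero] at hmn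
  rw [ratPoint_mk, ← Projectivization.mk_rep P]
  exact (Projectivization.mk_eq_mk_iff' _ _ _ _ _).mpr ⟨b, hmn⟩

/-- For every point of `L` there is a plane through `L` tangent at this point. -/
theorem exists_tangent_plane {K : Type*} [Field K] {F : MvPolynomial (Fin 4) K} {d : ℕ}
    (hF : F.IsHomogeneous d)
    {L : Submodule K (Fin 4 → K)} (hL : Module.finrank K L = 2) (hFL : VanishesOn F L)
    {u : Fin 4 → K} (huL : u ∈ L) :
    ∃ W, L ≤ W ∧ Module.finrank K W = 3 ∧ ∀ x ∈ W, gradFun F u x = 0 := by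
  -- The kernel is the whole space at a singular point; any plane through L is then tangent.
  have hker : 3 ≤ Module.finrank K (gradFun F u).ker := by
    have h1 := LinearMap.finrank_range_add_finrank_ker (gradFun F u)
    have h2 := Submodule.finrank_le (gradFun F u).range
    rw [Module.finrank_self] at h2
    rw [Module.finrank_fin_fun] at h1
    omega
  obtain ⟨w, hwk, hw⟩ := exists_notMem_of_finrank_lt (M := L) (W := (gradFun F u).ker) (by omega)
  refine ⟨L ⊔ K ∙ w, le_sup_left, by rw [finrank_sup_span_singleton hw, hL], fun x hx => ?_⟩
  have hle : L ⊔ K ∙ w ≤ (gradFun F u).ker := by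
    refine sup_le (fun x hx => ?_) ((Submodule.span_singleton_le_iff_mem w _).mpr hwk)
    exact hFL.gradFun_eq_zero hF huL hx
  exact hle hx

/-! ### Vertices and points of tangency -/

section Vertices

open scoped Classical

variable {K : Type*} [Field K] [Fintype K]

theorem exists_ne_of_mem_linesIn {F : MvPolynomial (Fin 4) K} {d : ℕ} (hd : 2 ≤ d)
    {W : Submodule K (Fin 4 → K)} (L : Submodule K (Fin 4 → K)) (hcard : (linesIn F W).card = d) :
    ∃ M ∈ linesIn F W, M ≠ L := by
  by_contra! h
  have := Finset.card_le_card (show linesIn F W ⊆ {L} from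
    fun M hM => Finset.mem_singleton.mpr (h M hM))
  rw [Finset.card_singleton] at this
  omega

/-- The differential at v vanishes on L and on a second line of S through v, and these two span W.
-/
theorem gradFun_eq_zero_of_vertex {F : MvPolynomial (Fin 4) K} {d : ℕ} (hF : F.IsHomogeneous d)
    (hd : 2 ≤ d) {L W : Submodule K (Fin 4 → K)} (hLW : L ≤ W) (hW : Module.finrank K W = 3)
    (hL : Module.finrank K L = 2) (hFL : VanishesOn F L) (hcard : (linesIn F W).card = d)
    {v : Fin 4 → K} (hvL : v ∈ L) (hv : ∀ M ∈ linesIn F W, v ∈ M) {x : Fin 4 → K} (hx : x ∈ W) :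
    gradFun F v x = 0 := by
  obtain ⟨M, hM, hne⟩ := exists_ne_of_mem_linesIn hd L hcard
  obtain ⟨hMW, hM2, hFM⟩ := mem_linesIn.mp hM
  have : ∃ a ∈ M, a ∉ L := by
    by_contra! hle
    exact hne (Submodule.eq_of_le_of_finrank_eq hle (by rw [hM2, hL]))
  obtain ⟨a, haM, haL⟩ := this
  obtain ⟨m, hm, c, rfl⟩ := exists_add_smul_eq hLW (by rw [hW, hL]) (hMW haM) haL hx
  rw [map_add, map_smul, hFL.gradFun_eq_zero hF hvL hm, hFM.gradFun_eq_zero hF (hv M hM) haM,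
    smul_zero, add_zero]

/-- A plane is tangent only at its vertex. -/
theorem exists_smul_eq_of_gradFun {F : MvPolynomial (Fin 4) K} {d : ℕ} (hF : F.IsHomogeneous d)
    (hd : 2 ≤ d) {L W : Submodule K (Fin 4 → K)} (hLW : L ≤ W) (hW : Module.finrank K W = 3)
    (hL : Module.finrank K L = 2) (hFL : VanishesOn F L)
    (hall : ∀ w, w ∉ L → (fiberZeros F L w).card = (d - 1) * Fintype.card K)
    {v : Fin 4 → K} (hvL : v ∈ L) (hv0 : v ≠ 0) (hv : ∀ M ∈ linesIn F W, v ∈ M)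
    {u : Fin 4 → K} (huL : u ∈ L) (hu0 : u ≠ 0) (hg : ∀ x ∈ W, gradFun F u x = 0) :
    ∃ c : K, c • v = u := by
  obtain ⟨w, hwW, hw⟩ := exists_notMem_of_finrank_lt (M := L) (W := W) (by omega)
  obtain ⟨x, hxL, hx⟩ := exists_linePoly_eq_zero_of_gradFun hF hd hL hFL (hall w hw) huL
    fun x hx => hg _ (W.add_mem hwW (hLW hx))
  have hwx : w + x ∉ L := fun h => hw ((L.add_mem_iff_left hxL).mp h)
  have hM := span_pair_mem_linesIn hF hLW (W.add_mem hwW (hLW hxL)) hwx huL hu0 hx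
  have hvM := hv _ hM
  have hmem : w + x ∈ Submodule.span K {w + x, u} := Submodule.subset_span (by simp)
  have huM : u ∈ Submodule.span K {w + x, u} := Submodule.subset_span (by simp)
  obtain ⟨hMW, hM2, -⟩ := mem_linesIn.mp hM
  have hne : Submodule.span K {w + x, u} ≠ L := fun h => hwx (h ▸ hmem)
  exact exists_smul_eq_of_finrank_one (finrank_inf_eq_one hMW hLW hW hM2 hL hne)
    (Submodule.mem_inf.mpr ⟨hvM, hvL⟩) hv0 (Submodule.mem_inf.mpr ⟨huM, huL⟩)

/-- Different planes through `L` have different vertices. -/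
theorem eq_of_common_vertex {F : MvPolynomial (Fin 4) K} {d : ℕ} (hF : F.IsHomogeneous d)
    (hplane : HasNoPlaneComponent F) (hd : 2 ≤ d) (hdq : d ≤ Fintype.card K + 1)
    {L W W' : Submodule K (Fin 4 → K)}
    (hL : Module.finrank K L = 2) (hFL : VanishesOn F L)
    (hall : ∀ w, w ∉ L → (fiberZeros F L w).card = (d - 1) * Fintype.card K)
    (hLW : L ≤ W) (hW : Module.finrank K W = 3) (hLW' : L ≤ W') (hW' : Module.finrank K W' = 3)
    {v : Fin 4 → K} (hvL : v ∈ L) (hv0 : v ≠ 0) (hcard : (linesIn F W).card = d)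
    (hv : ∀ M ∈ linesIn F W, v ∈ M) (hcard' : (linesIn F W').card = d)
    (hv' : ∀ M ∈ linesIn F W', v ∈ M) : W = W' := by
  by_contra hne
  have h1 : W ≤ (gradFun F v).ker :=
    fun x hx => gradFun_eq_zero_of_vertex hF hd hLW hW hL hFL hcard hvL hv hx
  have h2 : W' ≤ (gradFun F v).ker :=
    fun x hx => gradFun_eq_zero_of_vertex hF hd hLW' hW' hL hFL hcard' hvL hv' hx
  have hlt : W < W ⊔ W' := by
    refine lt_of_le_of_ne le_sup_left fun h => hne ?_
    exact (Submodule.eq_of_le_of_finrank_eq (h ▸ le_sup_right : W' ≤ W) (by rw [hW, hW'])).symm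
  have htop : W ⊔ W' = ⊤ := by
    refine Submodule.eq_top_of_finrank_eq (le_antisymm (Submodule.finrank_le _) ?_)
    have := Submodule.finrank_lt_finrank_of_lt hlt
    rw [Module.finrank_fin_fun]
    omega
  have hgrad : ∀ x, gradFun F v x = 0 := fun x =>
    (sup_le h1 h2) (htop ▸ Submodule.mem_top : x ∈ W ⊔ W')
  obtain ⟨u, huL, huv⟩ := exists_notMem_of_finrank_lt (M := K ∙ v) (W := L)
    (by rw [finrank_span_singleton hv0, hL]; norm_num)
  have hu0 : u ≠ 0 := fun h => huv (h ▸ Submodule.zero_mem _)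
  -- T is tangent at u by choice and at v because v is singular, so u and v are both its vertex.
  obtain ⟨T, hLT, hT, hgT⟩ := exists_tangent_plane hF hL hFL huL
  obtain ⟨w, hwT, hw⟩ := exists_notMem_of_finrank_lt (M := L) (W := T) (by omega)
  obtain ⟨-, t, htL, ht0, ht⟩ :=
    exists_vertex hF hplane hd hdq hLT hT hL hFL hwT hw (hall w hw)
  obtain ⟨a, ha⟩ := exists_smul_eq_of_gradFun hF hd hLT hT hL hFL hall htL ht0 ht huL hu0 hgT
  obtain ⟨b, hb⟩ := exists_smul_eq_of_gradFun hF hd hLT hT hL hFL hall htL ht0 ht hvL hv0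
    fun x _ => hgrad x
  have hb0 : b ≠ 0 := by
    rintro rfl
    exact hv0 (by rw [← hb, zero_smul])
  refine huv (Submodule.mem_span_singleton.mpr ⟨a * b⁻¹, ?_⟩)
  rw [← hb, smul_smul, mul_assoc, inv_mul_cancel₀ hb0, mul_one, ha]

/-- The section of the surface by a plane that contains `d` lines of the surface through `v` is
a pencil with vertex `v`, and `v` is its only vertex. -/
theorem isPencilVertex_iff {F : MvPolynomial (Fin 4) K} {d : ℕ} (hF : F.IsHomogeneous d)
    (hplane : HasNoPlaneComponent F) (hd : 2 ≤ d) {L W : Submodule K (Fin 4 → K)} (hLW : L ≤ W)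
    (hW : Module.finrank K W = 3) (hL : Module.finrank K L = 2) (hFL : VanishesOn F L)
    {v : Fin 4 → K} (hv0 : v ≠ 0) (hcard : (linesIn F W).card = d)
    (hv : ∀ M ∈ linesIn F W, v ∈ M) (P : PThree K) :
    IsPencilVertex d (surfaceOf F ∩ linearLocus W) P ↔
      P = ratPoint K (Projectivization.mk K v hv0) := by
  have hd0 : d ≠ 0 := by omega
  constructor
  · rintro ⟨l, ⟨-, -, hrat, -, -, hZ⟩, hP⟩
    -- In any presentation of the section as a pencil, the lines belong to `linesIn F W`, so they
    -- all contain v.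
    have hmem : ratPoint K (Projectivization.mk K v hv0) ∈ ⋂ i, l i := by
      refine Set.mem_iInter.mpr fun i => ?_
      obtain ⟨M, hM2, hM⟩ := hrat i
      have hsub : l i ⊆ surfaceOf F ∩ linearLocus W := hZ ▸ Set.subset_iUnion l i
      rw [hM] at hsub ⊢
      rw [ratPoint_mk_mem_linearLocus]
      exact hv M (mem_linesIn.mpr ⟨linearLocus_subset_iff.mp (hsub.trans Set.inter_subset_right),
        hM2, (linearLocus_subset_surfaceOf_iff hF hd0).mp (hsub.trans Set.inter_subset_left)⟩)
    rw [hP] at hmem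
    exact hmem.symm
  · rintro rfl
    let e := (Finset.equivFinOfCardEq hcard).symm
    have hmemv : ∀ i, ratPoint K (Projectivization.mk K v hv0) ∈ linearLocus (e i).1 := fun i =>
      (ratPoint_mk_mem_linearLocus hv0).mpr (hv _ (e i).2)
    refine ⟨fun i => linearLocus (e i).1, ⟨hd, ?_, ?_, ?_, ?_, ?_⟩, ?_⟩
    · exact fun i j h => e.injective (Subtype.ext (linearLocus_injective h))
    · exact fun i => ⟨_, (mem_linesIn.mp (e i).2).2.1, rfl⟩
    · exact ⟨linearLocus W, ⟨W, hW, rfl⟩, fun i =>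
        linearLocus_subset_iff.mpr (mem_linesIn.mp (e i).2).1⟩
    · exact ⟨_, Set.mem_iInter.mpr hmemv⟩
    · refine Set.Subset.antisymm ?_ (Set.iUnion_subset fun i => Set.subset_inter ?_ ?_)
      · rintro Q ⟨hQS, hQW⟩
        obtain ⟨M, hM, hQM⟩ := (card_lines_aux hF hplane hW (linesIn F W)
          fun _ hM => mem_linesIn.mp hM).2 hcard _ (mem_linearLocus.mp hQW) hQS
        refine Set.mem_iUnion.mpr ⟨e.symm ⟨M, hM⟩, ?_⟩
        simp only [Equiv.apply_symm_apply]
        exact mem_linearLocus.mpr hQM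
      · exact (linearLocus_subset_surfaceOf_iff hF hd0).mpr (mem_linesIn.mp (e i).2).2.2
      · exact linearLocus_subset_iff.mpr (mem_linesIn.mp (e i).2).1
    · refine Set.Subset.antisymm (fun Q hQ => ?_)
        (Set.singleton_subset_iff.mpr (Set.mem_iInter.mpr hmemv))
      have hQ' : ∀ M ∈ linesIn F W, Q ∈ linearLocus M := by
        intro M hM
        have := Set.mem_iInter.mp hQ (e.symm ⟨M, hM⟩)
        simpa only [Equiv.apply_symm_apply] using this
      obtain ⟨M, hM, hne⟩ := exists_ne_of_mem_linesIn hd L hcard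
      have hM2 := (mem_linesIn.mp hM).2.1
      have hLmem : L ∈ linesIn F W := mem_linesIn.mpr ⟨hLW, hL, hFL⟩
      exact eq_ratPoint_of_mem_inter hL hM2 hne (hv L hLmem) (hv M hM) hv0
        (hQ' L hLmem) (hQ' M hM)

end Vertices

/-! ### The main theorem -/

theorem lemma3p4 {K : Type*} [Field K] [Finite K] (d : ℕ) (hd : 2 ≤ d) (hdq : d ≤ Nat.card K + 1)
    (F : MvPolynomial (Fin 4) K) (hF0 : F ≠ 0) (hF : F.IsHomogeneous d)
    (hplane : HasNoPlaneComponent F)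
    (hN : numRatPoints (surfaceOf F) = (d - 1) * Nat.card K ^ 2 + d * Nat.card K + 1)
    (l : Set (PThree K)) (hl : IsRatLine l) (hlS : l ⊆ surfaceOf F) :
    (∀ H ∈ ratPlanesThrough l, IsPlanarPencil d (surfaceOf F ∩ H)) ∧
    ∃ φ : ratPlanesThrough l → ratPoints l,
      (∀ (H : ratPlanesThrough l) (v : PThree K),
        IsPencilVertex d (surfaceOf F ∩ (H : Set (PThree K))) v ↔ v = (φ H : PThree K)) ∧
      Function.Bijective φ := by
  cases nonempty_fintype K
  rw [Nat.card_eq_fintype_card] at hdq hN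
  obtain ⟨L, hL, rfl⟩ := hl
  have hFL : VanishesOn F L := (linearLocus_subset_surfaceOf_iff hF (by omega)).mp hlS
  have hall : ∀ w, w ∉ L → (fiberZeros F L w).card = (d - 1) * Fintype.card K :=
    fun w hw => card_fiberZeros_eq hF hplane hd hdq hN hL hFL hw
  have hex : ∀ H : ratPlanesThrough (linearLocus L), ∃ (W : Submodule K (Fin 4 → K))
      (v : Fin 4 → K), (H : Set (PThree K)) = linearLocus W ∧ L ≤ W ∧ Module.finrank K W = 3 ∧
        (linesIn F W).card = d ∧ v ∈ L ∧ v ≠ 0 ∧ ∀ M ∈ linesIn F W, v ∈ M := by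
    rintro ⟨H, ⟨W, hW, rfl⟩, hLW⟩
    have hLW := linearLocus_subset_iff.mp hLW
    obtain ⟨w, hwW, hw⟩ := exists_notMem_of_finrank_lt (M := L) (W := W) (by omega)
    obtain ⟨hcard, v, hvL, hv0, hv⟩ :=
      exists_vertex hF hplane hd hdq hLW hW hL hFL hwW hw (hall w hw)
    exact ⟨W, v, rfl, hLW, hW, hcard, hvL, hv0, hv⟩
  choose W v hH hLW hW hcard hvL hv0 hv using hex
  have hvertex : ∀ (H : ratPlanesThrough (linearLocus L)) (P : PThree K),
      IsPencilVertex d (surfaceOf F ∩ (H : Set (PThree K))) P ↔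
        P = ratPoint K (Projectivization.mk K (v H) (hv0 H)) := by
    intro H P
    rw [hH H]
    exact isPencilVertex_iff hF hplane hd (hLW H) (hW H) hL hFL (hv0 H) (hcard H) (hv H) P
  refine ⟨fun H hH => ?_, fun H => ⟨ratPoint K (Projectivization.mk K (v H) (hv0 H)),
    (ratPoint_mk_mem_linearLocus (hv0 H)).mpr (hvL H), _, rfl⟩, hvertex, ?_, ?_⟩
  · obtain ⟨l, h, -⟩ := (hvertex ⟨H, hH⟩ _).mpr rfl
    exact ⟨l, h⟩
  · intro H H' h
    have h0 : ratPoint K (Projectivization.mk K (v H) (hv0 H)) =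
        ratPoint K (Projectivization.mk K (v H') (hv0 H')) := congrArg Subtype.val h
    have h1 := ratPoint_injective h0
    obtain ⟨c, hc⟩ := (Projectivization.mk_eq_mk_iff' K _ _ _ _).mp h1.symm
    have hWW : W H = W H' :=
      eq_of_common_vertex hF hplane hd hdq hL hFL hall (hLW H) (hW H) (hLW H') (hW H') (hvL H')
        (hv0 H') (hcard H) (fun M hM => hc ▸ M.smul_mem c (hv H M hM)) (hcard H') (hv H')
    exact Subtype.ext (by rw [hH H, hH H', hWW])
  · rintro ⟨P, hP, p, rfl⟩
    have hp0 := p.rep_nonzero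
    have hpL : p.rep ∈ L := by
      rw [← ratPoint_mk_mem_linearLocus hp0, Projectivization.mk_rep]
      exact hP
    -- The preimage of a point of L is a plane tangent there, since a plane through L is tangent at
    -- no point of L but its vertex.
    obtain ⟨T, hLT, hT, hg⟩ := exists_tangent_plane hF hL hFL hpL
    let H : ratPlanesThrough (linearLocus L) :=
      ⟨linearLocus T, ⟨T, hT, rfl⟩, linearLocus_subset_iff.mpr hLT⟩
    have hWT : W H = T := linearLocus_injective (hH H).symm
    obtain ⟨c, hc⟩ := exists_smul_eq_of_gradFun hF hd (hLW H) (hW H) hL hFL hall (hvL H) (hv0 H)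
      (hv H) hpL hp0 (by rw [hWT]; exact hg)
    refine ⟨H, Subtype.ext ?_⟩
    change ratPoint K (Projectivization.mk K (v H) (hv0 H)) = ratPoint K p
    congr 1
    rw [← Projectivization.mk_rep p]
    exact ((Projectivization.mk_eq_mk_iff' K _ _ _ _).mpr ⟨c, hc⟩).symm
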